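/- Let $b>0$ and let $\mu\in C^3[0,b]$ with $\mu(0)>0$ be the initial density profile, at time $t=0$, of a marginally bound spherical (Lemaître–Tolman) dust ball of initial radius $b$. Put $m(r)=\int_0^r x^2\mu(x)\,dx$ and assume, for all $r\in(0,b]$, that $m(r)>0$, that $m(r)<r$ (no trapped surfaces at $t=0$), and that $r\,m'(r)<3m(r)$ (no shell crossings). Let $t_c(r)=\frac23\sqrt{r^3/m(r)}$ for $r\in(0,b]$, $t_0=t_c(0):=\lim_{r\to0^+}t_c(r)=\frac23\sqrt{3/\mu(0)}$, and let $R(r,t)$ be given by $R^3=\frac94 m(r)(t_c(r)-t)^2$; the metric is $-dt^2+(R_{,r}dr)^2+R^2d\Omega^2$ on $0\le t<t_c(r)$. A geodesic with angular momentum $L\in\mathbb R$ is a solution $(t(s),r(s))$, $s$ an affine parameter, of $$\ddot t+R_{,r}R_{,rt}\dot r^2+R_{,t}\frac{L^2}{R^3}=0,\qquad R_{,r}\ddot r+R_{,rr}\dot r^2+2R_{,rt}\dot r\dot t-\frac{L^2}{R^3}=0,\qquad -\dot t^2+(R_{,r}\dot r)^2+\frac{L^2}{R^2}=-\epsilon,$$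 with $\epsilon=1$ in the timelike and $\epsilon=0$ in the null case; it is radial if $L=0$ and non-radial if $L\ne0$. It is future-pointing and emanates from the singularity if, for some $\delta>0$, it is defined for $s\in(0,\delta)$ with $\dot t\ge0$, $\dot t$ and $\dot r$ are integrable on $(0,\delta)$, and $r(s)\to0$, $t(s)\to t_0$ as $s\to0^+$. Then the following hold. (a) There is a future-pointing radial timelike geodesic emanating from the singularity if and only if there is a future-pointing radial null geodesic emanating from the singularity. (b) There is a future-pointing non-radial timelike geodesic emanating from the singularity if and only if there is a future-pointing radial null geodesic emanating from the singularity. (c) If no future-pointing radial null geodesic emanates from the singularity, then no future-pointing causal geodesic (timelike or null, radial or non-radial) emanates from it. -/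

import Mathlib

open Set Filter Topology MeasureTheory

noncomputable section

namespace MarginallyBoundDust

/-- The mass function `m(r) = ∫₀^r x² μ(x) dx` of the initial density profile `μ`. -/
def mass (μ : ℝ → ℝ) (r : ℝ) : ℝ := ∫ x in (0 : ℝ)..r, x ^ 2 * μ x

/-- The collapse time `t_c(r) = (2/3) √(r³ / m(r))` of the shell `r > 0`. -/
def collapseTime (μ : ℝ → ℝ) (r : ℝ) : ℝ := 2 / 3 * Real.sqrt (r ^ 3 / mass μ r)

/-- The collapse time `t₀ = t_c(0)` of the centre. Since `m(r) / r³ → μ(0) / 3` as `r → 0⁺`, the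
value `t_c(0) = lim_{r → 0⁺} t_c(r)` is `(2/3) √(3 / μ(0))`. -/
def centralTime (μ : ℝ → ℝ) : ℝ := 2 / 3 * Real.sqrt (3 / μ 0)

/-- The area radius, `R³ = (9/4) m(r) (t_c(r) - t)²`, of the line element
`ds² = -dt² + R_{,r}² dr² + R² dΩ²`. -/
def areaRadius (μ : ℝ → ℝ) (r t : ℝ) : ℝ :=
  (9 / 4 * mass μ r * (collapseTime μ r - t) ^ 2) ^ ((1 : ℝ) / 3)

/-- `R_{,r}`. -/
def areaRadius_r (μ : ℝ → ℝ) (r t : ℝ) : ℝ := deriv (fun r' => areaRadius μ r' t) r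

/-- `R_{,t}`. -/
def areaRadius_t (μ : ℝ → ℝ) (r t : ℝ) : ℝ := deriv (fun t' => areaRadius μ r t') t

/-- `R_{,rr}`. -/
def areaRadius_rr (μ : ℝ → ℝ) (r t : ℝ) : ℝ := deriv (fun r' => areaRadius_r μ r' t) r

/-- `R_{,rt}`. -/
def areaRadius_rt (μ : ℝ → ℝ) (r t : ℝ) : ℝ := deriv (fun t' => areaRadius_r μ r t') t

/-- Regular initial data at `t = 0` for a marginally bound dust ball of initial radius `b` with
initial density `μ`, subject to the condition that rules out shell crossings. -/
structure IsRegularData (b : ℝ) (μ : ℝ → ℝ) : Prop where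
  radius_pos : 0 < b
  contDiffOn : ContDiffOn ℝ 3 μ (Icc 0 b)
  central_density_pos : 0 < μ 0
  mass_pos : ∀ r ∈ Ioc 0 b, 0 < mass μ r
  /-- There are no trapped surfaces at `t = 0`: `m(r) < R(r, 0) = r`. -/
  no_trapped : ∀ r ∈ Ioc 0 b, mass μ r < r
  /-- No shell crossings: `r m_{,r} < 3 m`, where `m_{,r}(r) = r² μ(r)`. -/
  no_shell_crossing : ∀ r ∈ Ioc 0 b, r * (r ^ 2 * μ r) < 3 * mass μ r

/-- `s ↦ (t(s), r(s))`, `0 < s < δ`, is a geodesic with angular momentum `L` of the dust region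
`0 < r < b`, `0 ≤ t < t_c(r)`, with `s` an affine parameter. It is timelike (and `s` is proper
time) for `ε = 1` and null for `ε = 0`; it is radial if and only if `L = 0`. By spherical symmetry
the motion is in a plane through the centre, with polar angle `φ` given by `R² φ' = L`.
(A curve with `t' ≥ 0` and `t → t₀` as `s → 0⁺` has `t ≥ t₀`, so it never meets the regular
part `r = 0`, `t < t₀` of the centre.) -/
structure IsGeodesic (b : ℝ) (μ : ℝ → ℝ) (ε L δ : ℝ) (t r : ℝ → ℝ) : Prop where
  contDiffOn_t : ContDiffOn ℝ 2 t (Ioo 0 δ)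
  contDiffOn_r : ContDiffOn ℝ 2 r (Ioo 0 δ)
  r_mem : ∀ s ∈ Ioo 0 δ, r s ∈ Ioo 0 b
  t_mem : ∀ s ∈ Ioo 0 δ, t s ∈ Ico 0 (collapseTime μ (r s))
  eq_t : ∀ s ∈ Ioo 0 δ,
    deriv (deriv t) s
      + areaRadius_r μ (r s) (t s) * areaRadius_rt μ (r s) (t s) * deriv r s ^ 2
      + areaRadius_t μ (r s) (t s) * (L ^ 2 / areaRadius μ (r s) (t s) ^ 3) = 0
  eq_r : ∀ s ∈ Ioo 0 δ,
    areaRadius_r μ (r s) (t s) * deriv (deriv r) s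
      + areaRadius_rr μ (r s) (t s) * deriv r s ^ 2
      + 2 * areaRadius_rt μ (r s) (t s) * deriv r s * deriv t s
      - L ^ 2 / areaRadius μ (r s) (t s) ^ 3 = 0
  eq_norm : ∀ s ∈ Ioo 0 δ,
    -(deriv t s) ^ 2 + (areaRadius_r μ (r s) (t s) * deriv r s) ^ 2
      + L ^ 2 / areaRadius μ (r s) (t s) ^ 2 = -ε

/-- A future-pointing geodesic with angular momentum `L` (timelike for `ε = 1`, null for `ε = 0`)
emanates from the shell-focussing singularity `(r, t) = (0, t₀)`. -/
def Emanates (b : ℝ) (μ : ℝ → ℝ) (ε L : ℝ) : Prop :=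
  ∃ (δ : ℝ) (t r : ℝ → ℝ), 0 < δ ∧ IsGeodesic b μ ε L δ t r ∧
    (∀ s ∈ Ioo 0 δ, 0 ≤ deriv t s) ∧
    IntegrableOn (deriv t) (Ioo 0 δ) ∧ IntegrableOn (deriv r) (Ioo 0 δ) ∧
    Tendsto r (𝓝[>] 0) (𝓝 0) ∧ Tendsto t (𝓝[>] 0) (𝓝 (centralTime μ))

/-- A future-pointing radial null geodesic emanates from the singularity. -/
def RadialNullEmanates (b : ℝ) (μ : ℝ → ℝ) : Prop := Emanates b μ 0 0

/-- A future-pointing radial timelike geodesic emanates from the singularity. -/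
def RadialTimelikeEmanates (b : ℝ) (μ : ℝ → ℝ) : Prop := Emanates b μ 1 0

/-- A future-pointing non-radial timelike geodesic emanates from the singularity. -/
def NonradialTimelikeEmanates (b : ℝ) (μ : ℝ → ℝ) : Prop := ∃ L : ℝ, L ≠ 0 ∧ Emanates b μ 1 L

/-- Some future-pointing causal (timelike or null, radial or not) geodesic emanates from the
singularity. -/
def CausalEmanates (b : ℝ) (μ : ℝ → ℝ) : Prop :=
  ∃ ε L : ℝ, (ε = 0 ∨ ε = 1) ∧ Emanates b μ ε L

end MarginallyBoundDust

end

noncomputable section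

namespace MarginallyBoundDust

/-! ### Maximal solutions of autonomous differential equations -/

section ODE

variable {F : Type*} [NormedAddCommGroup F] [NormedSpace ℝ F]

/-! All geodesics are compared with the radial null slope `dt/dr = R_{,r}`. They are constructed by
solving the equations backwards in `s` from an untrapped point (`R > m`) and showing that the
solution ends at the singularity.

From causal to radial null (`radialNullEmanates_of_emanates`). A causal geodesic with `ε + L² > 0`
satisfies `R_{,r} r' < t'` strictly. It has untrapped points arbitrarily near the singularity, since
in the region `R ≤ m` the area radius could not increase along it, although `0 < R ≤ r → 0`
(`IsGeodesic.exists_untrapped`). From a point slightly inside such a point, a radial null ray is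
traced backwards. At a meeting point the ray would have the larger `dr/dt`, so it stays inside the
geodesic, and its radius is squeezed to `0` as `t → t₀`. That `t` really decreases to `t₀` follows
from the persistence of `R > m` backwards and from momentum bounds (`IsFlowLine.untrapped`,
`IsFlowLine.tendsto_centralTime`). This gives (c) and one direction of (a) and (b).

From radial null to timelike (`RadialNullEmanates.timelike`). A barrier is a causal curve `t = N(r)
> t₀` with `t_c - N = O(m)`. A geodesic traced backwards above it has `N(r) < t → t₀`, which forces
`r → 0`. To keep the geodesic above the barrier for arbitrary `L`, the product `(E + p)(t - N(r))`
is shown to exceed `Z₀ + 2s`, where `E = t'` and `p = R_{,r} r'`. In its derivative the terms with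
`R_{,rt}` cancel, and the quadratic gain from the convexity of `R_{,r}` in time beats the angular
terms, which are of order `L²/m²` (`radial_convexity`, `drift_le`, `IsBarrier.emanates`).

Barriers exist because `μ ∈ C³` makes `t_c'/r²` either diverge or converge
(`collapseRate_dichotomy`). If it diverges, the curve `R = 4m` is a barrier. If it converges, then
`t_c - t₀ = O(r³) = O(m)`, and the given null ray is itself a barrier. -/

/-- A local flow of a `C¹` vector field on an open set, with a uniform existence time. -/
lemma exists_uniform_local_solution [CompleteSpace F] {f : F → F} {U : Set F} (hU : IsOpen U)
    (hf : ContDiffOn ℝ 1 f U) {x : F} (hx : x ∈ U) :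
    ∃ ρ > (0 : ℝ), ∃ η > (0 : ℝ), ∀ z ∈ Metric.closedBall x ρ, ∀ s₀ : ℝ, ∃ α : ℝ → F, α s₀ = z ∧
      ∀ s ∈ Ioo (s₀ - η) (s₀ + η), α s ∈ U ∧ HasDerivAt α (f (α s)) s := by
  obtain ⟨e, he, a, r, L, K, hr, hpl⟩ :=
    IsPicardLindelof.of_contDiffAt_one (hf.contDiffAt (hU.mem_nhds hx))
  obtain ⟨α, hα, hc⟩ := (hpl 0).exists_forall_mem_closedBall_eq_hasDerivWithinAt_continuousOn
  have hr' : (0 : ℝ) < r := hr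
  have hmem : (Metric.closedBall x (r : ℝ)) ×ˢ Icc (0 - e) (0 + e) ∈ 𝓝 ((x, 0) : F × ℝ) :=
    prod_mem_nhds (Metric.closedBall_mem_nhds _ hr') (Icc_mem_nhds (by linarith) (by linarith))
  have h0 : α (x, 0) = x := (hα x (Metric.mem_closedBall_self hr'.le)).1
  have hca : ContinuousAt α (x, 0) := hc.continuousAt hmem
  have hpre : α ⁻¹' U ∈ 𝓝 ((x, 0) : F × ℝ) := by
    apply hca; rw [h0]; exact hU.mem_nhds hx
  obtain ⟨d, hd, hsub⟩ := Metric.mem_nhds_iff.1 (inter_mem hmem hpre)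
  refine ⟨d / 2, by positivity, min e d, lt_min he hd, fun z hz s₀ => ?_⟩
  have key : ∀ s : ℝ, |s| < min e d → (z, s) ∈
      (Metric.closedBall x (r : ℝ)) ×ˢ Icc (0 - e) (0 + e) ∩ α ⁻¹' U := by
    intro s hs
    apply hsub
    rw [Metric.mem_ball, Prod.dist_eq, max_lt_iff]
    refine ⟨?_, ?_⟩
    · have := Metric.mem_closedBall.1 hz
      dsimp; linarith
    · simpa [Real.dist_eq] using hs.trans_le (min_le_right _ _)
  have hz' : z ∈ Metric.closedBall x (r : ℝ) := (key 0 (by simpa using ⟨he, hd⟩)).1.1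
  refine ⟨fun s => α (z, s - s₀), by simpa using (hα z hz').1, fun s hs => ?_⟩
  have hs' : |s - s₀| < min e d := by
    rw [abs_lt]; constructor <;> linarith [hs.1, hs.2]
  refine ⟨(key _ hs').2, ?_⟩
  have h1 : |s - s₀| < e := hs'.trans_le (min_le_left _ _)
  rw [abs_lt] at h1
  have h2 : HasDerivAt (fun u => α (z, u)) (f (α (z, s - s₀))) (s - s₀) :=
    ((hα z hz').2 (s - s₀) ⟨by linarith, by linarith⟩).hasDerivAt
      (Icc_mem_nhds (by linarith) (by linarith))
  exact h2.comp_sub_const s s₀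

/-- A `C¹` field is only locally Lipschitz on `U`, so the closed set where the two solutions agree
is extended to the right step by step. -/
lemma solution_unique {f : F → F} {U : Set F} (hU : IsOpen U)
    (hf : ContDiffOn ℝ 1 f U) {τ : ℝ} {α β : ℝ → F}
    (hα : ∀ s ∈ Icc 0 τ, α s ∈ U ∧ HasDerivAt α (f (α s)) s)
    (hβ : ∀ s ∈ Icc 0 τ, β s ∈ U ∧ HasDerivAt β (f (β s)) s) (h0 : α 0 = β 0) :
    EqOn α β (Icc 0 τ) := by
  rcases lt_or_ge τ 0 with hτ | hτ
  · rw [Icc_eq_empty (by linarith)]; exact fun _ h => h.elim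
  have hαc : ContinuousOn α (Icc 0 τ) := HasDerivAt.continuousOn fun s hs => (hα s hs).2
  have hβc : ContinuousOn β (Icc 0 τ) := HasDerivAt.continuousOn fun s hs => (hβ s hs).2
  refine IsClosed.Icc_subset_of_forall_mem_nhdsWithin (s := {s | α s = β s}) ?_ h0 ?_
  · have := (hαc.prodMk hβc).preimage_isClosed_of_isClosed isClosed_Icc isClosed_diagonal
    convert this using 1
    ext s; simp [and_comm]
  · rintro s ⟨hs, hs1⟩
    have hs' : s ∈ Icc 0 τ := Ico_subset_Icc_self hs1
    obtain ⟨K, V, hV, hL⟩ :=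
      (hf.contDiffAt (hU.mem_nhds (hα s hs').1)).exists_lipschitzOnWith
    have e1 : ∀ᶠ u in 𝓝 s, α u ∈ V := (hα s hs').2.continuousAt hV
    have e2 : ∀ᶠ u in 𝓝 s, β u ∈ V := by
      apply (hβ s hs').2.continuousAt
      rw [← show α s = β s from hs]; exact hV
    obtain ⟨d, hd, hball⟩ := Metric.eventually_nhds_iff.1 (e1.and e2)
    set c := min (s + d / 2) τ with hc
    have hsc : s < c := lt_min (by linarith) hs1.2
    have hsub : Icc s c ⊆ Icc 0 τ := Icc_subset_Icc hs1.1 (min_le_right _ _)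
    have hin : ∀ u ∈ Ico s c, α u ∈ V ∧ β u ∈ V := by
      intro u hu
      apply hball
      rw [Real.dist_eq, abs_of_nonneg (by linarith [hu.1])]
      have : c ≤ s + d / 2 := min_le_left _ _
      linarith [hu.2]
    have := ODE_solution_unique_of_mem_Icc_right (v := fun _ => f) (s := fun _ => V) (K := K)
      (fun _ _ => hL) (hαc.mono hsub)
      (fun u hu => (hα u (hsub (Ico_subset_Icc_self hu))).2.hasDerivWithinAt)
      (fun u hu => (hin u hu).1) (hβc.mono hsub)
      (fun u hu => (hβ u (hsub (Ico_subset_Icc_self hu))).2.hasDerivWithinAt)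
      (fun u hu => (hin u hu).2) hs
    exact mem_of_superset (Icc_mem_nhdsGT hsc) this

/-- A solution can be followed forwards until time `B`, or until it leaves every compact set. -/
lemma exists_maximal_solution [CompleteSpace F] {f : F → F} {U : Set F} (hU : IsOpen U)
    (hf : ContDiffOn ℝ 1 f U) {x : F} (hx : x ∈ U) {B : ℝ} (hB : 0 < B) :
    ∃ T ∈ Ioc 0 B, ∃ α : ℝ → F, α 0 = x ∧
      (∀ s ∈ Ico 0 T, α s ∈ U ∧ HasDerivAt α (f (α s)) s) ∧
      (T = B ∨ ∀ K ⊆ U, IsCompact K → ∃ s ∈ Ico 0 T, α s ∉ K) := by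
  obtain ⟨ρ₀, hρ₀, η, hη, hloc⟩ := exists_uniform_local_solution hU hf hx
  obtain ⟨α₀, hα₀, hα₀'⟩ := hloc x (Metric.mem_closedBall_self hρ₀.le) 0
  -- Every candidate is pinned to `α₀` for nonpositive times, so that the glued curve has a
  -- two-sided derivative at `0`.
  let S : Set ℝ := {τ | 0 < τ ∧ τ ≤ B ∧ ∃ α : ℝ → F, EqOn α α₀ (Iic 0) ∧
    ∀ s ∈ Icc 0 τ, α s ∈ U ∧ HasDerivAt α (f (α s)) s}
  have hSne : min (η / 2) B ∈ S := by
    refine ⟨by positivity, min_le_right _ _, α₀, fun _ _ => rfl, fun s hs => hα₀' s ⟨?_, ?_⟩⟩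
    · linarith [hs.1]
    · have := min_le_left (η / 2) B
      linarith [hs.2]
  have hSb : BddAbove S := ⟨B, fun τ hτ => hτ.2.1⟩
  set T := sSup S with hT
  have hT0 : 0 < T := lt_of_lt_of_le hSne.1 (le_csSup hSb hSne)
  have hTB : T ≤ B := csSup_le ⟨_, hSne⟩ fun τ hτ => hτ.2.1
  have hex : ∀ s, s < T → ∃ τ, s < τ ∧ τ ∈ S := fun s hs => by
    obtain ⟨τ, h1, h2⟩ := exists_lt_of_lt_csSup ⟨_, hSne⟩ hs
    exact ⟨τ, h2, h1⟩
  choose! τ hτ1 hτ2 using hex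
  have hS : ∀ τ ∈ S, ∃ α : ℝ → F, EqOn α α₀ (Iic 0) ∧
    ∀ s ∈ Icc 0 τ, α s ∈ U ∧ HasDerivAt α (f (α s)) s := fun τ h => h.2.2
  choose! A hA1 hA2 using hS
  let γ : ℝ → F := fun s => A (τ s) s
  have hγ : ∀ σ ∈ S, ∀ s ≤ σ, s < T → γ s = A σ s := by
    intro σ hσ s hs hsT
    rcases le_or_gt s 0 with h | h
    · exact (hA1 _ (hτ2 s hsT) h).trans (hA1 σ hσ h).symm
    · have : EqOn (A (τ s)) (A σ) (Icc 0 s) := by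
        apply solution_unique hU hf
        · exact fun u hu => hA2 _ (hτ2 s hsT) u ⟨hu.1, hu.2.trans (hτ1 s hsT).le⟩
        · exact fun u hu => hA2 _ hσ u ⟨hu.1, hu.2.trans hs⟩
        · exact (hA1 _ (hτ2 s hsT) (mem_Iic.2 le_rfl)).trans (hA1 σ hσ (mem_Iic.2 le_rfl)).symm
      exact this ⟨h.le, le_rfl⟩
  have hγd : ∀ s ∈ Ico 0 T, γ s ∈ U ∧ HasDerivAt γ (f (γ s)) s := by
    intro s hs
    have hσ := hτ2 s hs.2
    have hlt := hτ1 s hs.2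
    have heq : γ =ᶠ[𝓝 s] A (τ s) := by
      filter_upwards [Iio_mem_nhds hlt, Iio_mem_nhds hs.2] with u hu hu'
      exact hγ _ hσ u (le_of_lt hu) hu'
    have := hA2 _ hσ s ⟨hs.1, hlt.le⟩
    exact ⟨this.1, this.2.congr_of_eventuallyEq heq⟩
  have hγ0 : EqOn γ α₀ (Iic 0) := fun s hs =>
    hA1 _ (hτ2 s (lt_of_le_of_lt hs hT0)) hs
  refine ⟨T, ⟨hT0, hTB⟩, γ, (hγ0 (mem_Iic.2 le_rfl)).trans hα₀, hγd, ?_⟩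
  by_contra hcon
  push Not at hcon
  obtain ⟨hne, K, hKU, hK, hin⟩ := hcon
  have hTB' : T < B := lt_of_le_of_ne hTB hne
  -- A cluster point in `K` as `s ↑ T` has a neighbourhood with a uniform existence time. Restarting
  -- from a nearby point of the curve passes `T`, against the choice of the supremum.
  obtain ⟨z, hz, hcl⟩ := hK.exists_mapClusterPt (f := 𝓝[<] T) (u := γ) (by
    rw [le_principal_iff, mem_map]
    filter_upwards [Ioo_mem_nhdsLT hT0] with s hs
    exact hin s ⟨hs.1.le, hs.2⟩)
  obtain ⟨ρ, hρ, e, he, hl⟩ := exists_uniform_local_solution hU hf (hKU hz)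
  have hfr := hcl.frequently (Metric.closedBall_mem_nhds z hρ)
  obtain ⟨s₀, hs₀, hs₁⟩ := (hfr.and_eventually
    (Ioo_mem_nhdsLT (show max 0 (T - e / 2) < T from max_lt hT0 (by linarith)))).exists
  have hs0 : 0 < s₀ := (le_max_left _ _).trans_lt hs₁.1
  have hsT : T - e / 2 < s₀ := (le_max_right _ _).trans_lt hs₁.1
  obtain ⟨β, hβ0, hβ⟩ := hl _ hs₀ s₀
  let δ : ℝ → F := fun s => if s ≤ s₀ then γ s else β s
  set σ := min (s₀ + e / 2) B with hσ
  have hσT : T < σ := lt_min (by linarith) hTB'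
  have hσs : σ ≤ s₀ + e / 2 := min_le_left _ _
  have : σ ∈ S := by
    refine ⟨hT0.trans hσT, min_le_right _ _, δ, ?_, ?_⟩
    · intro s hs
      have hs' : s ≤ 0 := hs
      simp only [δ, if_pos (hs'.trans hs0.le)]
      exact hγ0 hs
    · intro s hs
      rcases lt_trichotomy s s₀ with h | h | h
      · have heq : δ =ᶠ[𝓝 s] γ := by
          filter_upwards [Iio_mem_nhds h] with u hu
          simp only [δ, if_pos (le_of_lt (mem_Iio.1 hu))]
        have h1 := hγd s ⟨hs.1, h.trans hs₁.2⟩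
        simp only [heq.eq_of_nhds]
        exact ⟨h1.1, h1.2.congr_of_eventuallyEq heq⟩
      · subst h
        have h1 := hγd s ⟨hs.1, hs₁.2⟩
        have h2 := hβ s ⟨by linarith, by linarith⟩
        have hδ : δ s = γ s := by simp [δ]
        rw [hδ]
        refine ⟨h1.1, ?_⟩
        rw [hβ0] at h2
        have l : HasDerivWithinAt δ (f (γ s)) (Iic s) s :=
          h1.2.hasDerivWithinAt.congr (fun u hu => if_pos hu) hδ
        have r : HasDerivWithinAt δ (f (γ s)) (Ici s) s := by
          refine h2.2.hasDerivWithinAt.congr (fun u hu => ?_) (hδ.trans hβ0.symm)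
          rcases eq_or_lt_of_le (show s ≤ u from hu) with h | h
          · subst h; exact hδ.trans hβ0.symm
          · exact if_neg (not_le.2 h)
        simpa [hasDerivWithinAt_univ] using l.union r
      · have heq : δ =ᶠ[𝓝 s] β := by
          filter_upwards [Ioi_mem_nhds h] with u hu
          simp only [δ, if_neg (not_le.2 (mem_Ioi.1 hu))]
        have h1 := hβ s ⟨by linarith, by linarith [hs.2]⟩
        simp only [heq.eq_of_nhds]
        exact ⟨h1.1, h1.2.congr_of_eventuallyEq heq⟩
  exact absurd (le_csSup hSb this) (not_le.2 hσT)

/-- A solution can be followed backwards for time `B`, or until it leaves every compact set. -/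
lemma exists_backward_maximal_solution [CompleteSpace F] {f : F → F} {U : Set F} (hU : IsOpen U)
    (hf : ContDiffOn ℝ 1 f U) {x : F} (hx : x ∈ U) {B : ℝ} (hB : 0 < B) :
    ∃ T ∈ Ioc 0 B, ∃ γ : ℝ → F, γ T = x ∧
      (∀ s ∈ Ioc 0 T, γ s ∈ U ∧ HasDerivAt γ (f (γ s)) s) ∧
      (T = B ∨ ∀ K ⊆ U, IsCompact K → ∃ s ∈ Ioc 0 T, γ s ∉ K) := by
  -- Backwards for `f` is forwards for `-f`; the substitution `s ↦ T - s` turns one into the other.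
  obtain ⟨T, hT, α, hα0, hα, hesc⟩ := exists_maximal_solution hU hf.neg hx hB
  have hmem : ∀ s ∈ Ioc 0 T, T - s ∈ Ico 0 T := fun s hs =>
    ⟨by linarith [hs.2], by linarith [hs.1]⟩
  refine ⟨T, hT, fun s => α (T - s), by simpa using hα0, fun s hs => ?_, ?_⟩
  · have h := hα _ (hmem s hs)
    refine ⟨h.1, ?_⟩
    have := h.2.comp_const_sub T s
    simpa using this
  · refine hesc.imp id fun h K hK hKc => ?_
    obtain ⟨s, hs, hsK⟩ := h K hK hKc
    exact ⟨T - s, ⟨by linarith [hs.2], by linarith [hs.1]⟩, by simpa using hsK⟩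

end ODE

/-- A function that is positive at `T` and decreasing at each of its zeros is positive on
`(0, T]`. -/
lemma pos_of_deriv_neg_at_zeros {T : ℝ} {h h' : ℝ → ℝ}
    (hd : ∀ s ∈ Ioc 0 T, HasDerivAt h (h' s) s) (hT : 0 < h T)
    (hz : ∀ s ∈ Ioo 0 T, h s = 0 → (∀ u ∈ Ioc s T, 0 < h u) → h' s < 0) :
    ∀ s ∈ Ioc 0 T, 0 < h s := by
  by_contra! hcon
  obtain ⟨s₁, hs₁, hle⟩ := hcon
  have hc : ContinuousOn h (Icc s₁ T) := HasDerivAt.continuousOn fun s hs =>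
    hd s ⟨hs₁.1.trans_le hs.1, hs.2⟩
  have hcl : IsClosed (Icc s₁ T ∩ h ⁻¹' Iic 0) :=
    hc.preimage_isClosed_of_isClosed isClosed_Icc isClosed_Iic
  have hcomp : IsCompact (Icc s₁ T ∩ h ⁻¹' Iic 0) :=
    isCompact_Icc.of_isClosed_subset hcl inter_subset_left
  obtain ⟨s, ⟨hs, hhs⟩, hmax⟩ := hcomp.exists_isGreatest ⟨s₁, ⟨le_rfl, hs₁.2⟩, hle⟩
  have hhs' : h s ≤ 0 := hhs
  have hsT : s < T := lt_of_le_of_ne hs.2 fun e => by subst e; linarith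
  have hpos : ∀ u ∈ Ioc s T, 0 < h u := fun u hu => by
    by_contra hn
    exact absurd (hmax ⟨⟨hs.1.trans hu.1.le, hu.2⟩, not_lt.1 hn⟩) (not_le.2 hu.1)
  have hs0 : 0 < s := hs₁.1.trans_le hs.1
  have hd' := hd s ⟨hs0, hs.2⟩
  have h0 : h s = 0 := by
    refine le_antisymm hhs' ?_
    refine ge_of_tendsto (hd'.continuousAt.tendsto.mono_left nhdsWithin_le_nhds :
      Tendsto h (𝓝[>] s) _) ?_
    filter_upwards [Ioo_mem_nhdsGT hsT] with u hu
    exact (hpos u ⟨hu.1, hu.2.le⟩).le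
  have hneg := hz s ⟨hs0, hsT⟩ h0 hpos
  -- At the last zero before `T` the slopes to the right are positive, which contradicts a negative
  -- derivative.
  have hsl := (hasDerivAt_iff_tendsto_slope.1 hd').mono_left
    (nhdsWithin_mono s (fun u (hu : u ∈ Ioi s) => ne_of_gt (mem_Ioi.1 hu)))
  obtain ⟨u, hu1, hu2⟩ := ((hsl.eventually (gt_mem_nhds hneg)).and (Ioo_mem_nhdsGT hsT)).exists
  have : 0 < slope h s u := by
    rw [slope_def_field, h0, sub_zero]
    exact div_pos (hpos u ⟨hu2.1, hu2.2.le⟩) (by linarith [hu2.1])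
  linarith

/-! ### The mass function and the collapse time -/

/-- `m_{,r} / (3 m)`. -/
def massRate (μ : ℝ → ℝ) (r : ℝ) : ℝ := r ^ 2 * μ r / (3 * mass μ r)

/-- The derivative of the collapse time. -/
def collapseRate (μ : ℝ → ℝ) (r : ℝ) : ℝ :=
  collapseTime μ r * (3 * mass μ r - r ^ 3 * μ r) / (2 * r * mass μ r)

section Data

variable {b : ℝ} {μ : ℝ → ℝ}

lemma IsRegularData.contDiffOn_Ioo (hμ : IsRegularData b μ) : ContDiffOn ℝ 3 μ (Ioo 0 b) :=
  hμ.contDiffOn.mono Ioo_subset_Icc_self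

lemma IsRegularData.continuousOn (hμ : IsRegularData b μ) : ContinuousOn μ (Icc 0 b) :=
  hμ.contDiffOn.continuousOn

lemma IsRegularData.mass_pos' (hμ : IsRegularData b μ) {r : ℝ} (hr : r ∈ Ioo 0 b) :
    0 < mass μ r := hμ.mass_pos r (Ioo_subset_Ioc_self hr)

lemma hasDerivAt_mass (hμ : IsRegularData b μ) {r : ℝ} (hr : r ∈ Ioo 0 b) :
    HasDerivAt (mass μ) (r ^ 2 * μ r) r := by
  have hc : ContinuousOn (fun x => x ^ 2 * μ x) (Icc 0 b) :=
    (continuousOn_id.pow 2).mul hμ.continuousOn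
  have hint : IntervalIntegrable (fun x => x ^ 2 * μ x) volume 0 r := by
    apply ContinuousOn.intervalIntegrable
    rw [uIcc_of_le hr.1.le]
    exact hc.mono (Icc_subset_Icc_right hr.2.le)
  refine intervalIntegral.integral_hasDerivAt_right hint ?_ ?_
  · exact (hc.mono Ioo_subset_Icc_self).stronglyMeasurableAtFilter isOpen_Ioo r hr
  · exact hc.continuousAt (Icc_mem_nhds hr.1 hr.2)

lemma contDiffOn_mass (hμ : IsRegularData b μ) : ContDiffOn ℝ 1 (mass μ) (Ioo 0 b) := by
  rw [show (1 : WithTop ℕ∞) = 0 + 1 by norm_num, contDiffOn_succ_iff_deriv_of_isOpen isOpen_Ioo]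
  refine ⟨fun r hr => (hasDerivAt_mass hμ hr).differentiableAt.differentiableWithinAt,
    fun h => by simp at h, contDiffOn_zero.2 ?_⟩
  have : ContinuousOn (fun x => x ^ 2 * μ x) (Ioo 0 b) :=
    ((continuousOn_id.pow 2).mul hμ.continuousOn).mono Ioo_subset_Icc_self
  exact this.congr fun r hr => (hasDerivAt_mass hμ hr).deriv

lemma tendsto_mass_zero (hμ : IsRegularData b μ) : Tendsto (mass μ) (𝓝[>] 0) (𝓝 0) := by
  refine squeeze_zero' (f := mass μ) (g := fun r => r) ?_ ?_
    (tendsto_id.mono_left nhdsWithin_le_nhds)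
  · filter_upwards [Ioo_mem_nhdsGT hμ.radius_pos] with r hr using (hμ.mass_pos' hr).le
  · filter_upwards [Ioo_mem_nhdsGT hμ.radius_pos] with r hr
    exact (hμ.no_trapped r (Ioo_subset_Ioc_self hr)).le

lemma tendsto_density (hμ : IsRegularData b μ) : Tendsto μ (𝓝[>] 0) (𝓝 (μ 0)) :=
  (hμ.continuousOn 0 ⟨le_rfl, hμ.radius_pos.le⟩).mono_left
    (nhdsWithin_le_of_mem (mem_of_superset (Ioo_mem_nhdsGT hμ.radius_pos) Ioo_subset_Icc_self))

lemma tendsto_mass_div (hμ : IsRegularData b μ) :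
    Tendsto (fun r => mass μ r / r ^ 3) (𝓝[>] 0) (𝓝 (μ 0 / 3)) := by
  refine HasDerivAt.lhopital_zero_nhdsGT (f' := fun r => r ^ 2 * μ r) (g' := fun r => 3 * r ^ 2)
    ?_ ?_ ?_ (tendsto_mass_zero hμ) ?_ ?_
  · filter_upwards [Ioo_mem_nhdsGT hμ.radius_pos] with r hr using hasDerivAt_mass hμ hr
  · exact Eventually.of_forall fun r => by simpa using hasDerivAt_pow 3 r
  · filter_upwards [self_mem_nhdsWithin] with r (hr : 0 < r)
    positivity
  · exact (Continuous.tendsto' (by fun_prop) 0 0 (by simp)).mono_left nhdsWithin_le_nhds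
  · refine ((tendsto_density hμ).div_const 3).congr' ?_
    filter_upwards [self_mem_nhdsWithin] with r (hr : 0 < r)
    field_simp

lemma tendsto_collapseTime (hμ : IsRegularData b μ) :
    Tendsto (collapseTime μ) (𝓝[>] 0) (𝓝 (centralTime μ)) := by
  have h := (tendsto_mass_div hμ).inv₀ (by have := hμ.central_density_pos; positivity)
  simp only [inv_div] at h
  exact ((Real.continuous_sqrt.tendsto _).comp h).const_mul (2 / 3)

lemma collapseTime_pos (hμ : IsRegularData b μ) {r : ℝ} (hr : r ∈ Ioo 0 b) :
    0 < collapseTime μ r := by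
  have := hμ.mass_pos' hr
  have := hr.1
  unfold collapseTime
  positivity

lemma centralTime_pos (hμ : IsRegularData b μ) : 0 < centralTime μ := by
  have := hμ.central_density_pos
  unfold centralTime
  positivity

/-- This is the normalisation `R(r, 0) = r`. -/
lemma collapseTime_sq (hμ : IsRegularData b μ) {r : ℝ} (hr : r ∈ Ioo 0 b) :
    9 / 4 * mass μ r * collapseTime μ r ^ 2 = r ^ 3 := by
  have h1 := hμ.mass_pos' hr
  have h2 := hr.1
  unfold collapseTime
  rw [mul_pow, Real.sq_sqrt (by positivity)]
  field_simp
  norm_num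

lemma collapseRate_pos (hμ : IsRegularData b μ) {r : ℝ} (hr : r ∈ Ioo 0 b) :
    0 < collapseRate μ r := by
  have h1 := hμ.mass_pos' hr
  have h2 := hr.1
  have h3 := hμ.no_shell_crossing r (Ioo_subset_Ioc_self hr)
  have h4 := collapseTime_pos hμ hr
  have h5 : 0 < 3 * mass μ r - r ^ 3 * μ r := by linarith [h3, show r * (r ^ 2 * μ r) = r ^ 3 * μ r by ring]
  unfold collapseRate
  positivity

lemma hasDerivAt_collapseTime (hμ : IsRegularData b μ) {r : ℝ} (hr : r ∈ Ioo 0 b) :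
    HasDerivAt (collapseTime μ) (collapseRate μ r) r := by
  have h1 := hμ.mass_pos' hr
  have h2 := hr.1
  have h4 := collapseTime_pos hμ hr
  have h5 : (0 : ℝ) < r ^ 3 / mass μ r := by positivity
  have hd := ((((hasDerivAt_pow 3 r).div (hasDerivAt_mass hμ hr) h1.ne').sqrt h5.ne').const_mul
    (2 / 3 : ℝ))
  refine hd.congr_deriv ?_
  have hs := Real.sq_sqrt h5.le
  have hs0 : 0 < √(r ^ 3 / mass μ r) := Real.sqrt_pos.2 h5
  rw [eq_div_iff h1.ne'] at hs
  unfold collapseRate collapseTime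
  simp only [Pi.div_apply]
  generalize √(r ^ 3 / mass μ r) = q at *
  field_simp
  push_cast
  linear_combination (-(3 * mass μ r - r ^ 3 * μ r)) * hs

lemma contDiffOn_collapseTime (hμ : IsRegularData b μ) :
    ContDiffOn ℝ 1 (collapseTime μ) (Ioo 0 b) := by
  unfold collapseTime
  refine contDiffOn_const.mul (ContDiffOn.sqrt ((contDiffOn_id.pow 3).div (contDiffOn_mass hμ) ?_) ?_)
  · exact fun r hr => (hμ.mass_pos' hr).ne'
  · intro r hr
    have := hμ.mass_pos' hr
    have := hr.1
    positivity

lemma contDiffOn_massRate (hμ : IsRegularData b μ) : ContDiffOn ℝ 1 (massRate μ) (Ioo 0 b) := by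
  have h := hμ.contDiffOn_Ioo.of_le (show (1 : WithTop ℕ∞) ≤ 3 by norm_num)
  exact ((contDiffOn_id.pow 2).mul h).div (contDiffOn_const.mul (contDiffOn_mass hμ))
    fun r hr => by have := hμ.mass_pos' hr; positivity

lemma contDiffOn_collapseRate (hμ : IsRegularData b μ) :
    ContDiffOn ℝ 1 (collapseRate μ) (Ioo 0 b) := by
  have h := hμ.contDiffOn_Ioo.of_le (show (1 : WithTop ℕ∞) ≤ 3 by norm_num)
  refine ((contDiffOn_collapseTime hμ).mul ((contDiffOn_const.mul (contDiffOn_mass hμ)).sub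
    ((contDiffOn_id.pow 3).mul h))).div ((contDiffOn_const.mul contDiffOn_id).mul
      (contDiffOn_mass hμ)) fun r hr => ?_
  have := hμ.mass_pos' hr
  have := hr.1
  positivity

/-! ### The area radius and its derivatives -/

/-- `(2/3) R / (t_c - t) = √(m / R)`, which is `-R_{,t}`. -/
def trapping (μ : ℝ → ℝ) (r t : ℝ) : ℝ :=
  2 / 3 * areaRadius μ r t / (collapseTime μ r - t)

/-- `R_{,r} / R`. -/
def radialLogRate (μ : ℝ → ℝ) (r t : ℝ) : ℝ :=
  massRate μ r + 2 / 3 * collapseRate μ r / (collapseTime μ r - t)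

/-- `R_{,rt} / R`. -/
def mixedLogRate (μ : ℝ → ℝ) (r t : ℝ) : ℝ :=
  -(2 / 3) * massRate μ r / (collapseTime μ r - t)
    + 2 / 9 * collapseRate μ r / (collapseTime μ r - t) ^ 2

/-- `R_{,rt} / R_{,r}`. -/
def hubble (μ : ℝ → ℝ) (r t : ℝ) : ℝ := mixedLogRate μ r t / radialLogRate μ r t

lemma areaRadius_pos (hμ : IsRegularData b μ) {r t : ℝ} (hr : r ∈ Ioo 0 b)
    (ht : t < collapseTime μ r) : 0 < areaRadius μ r t := by
  have h1 := hμ.mass_pos' hr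
  have h2 : 0 < collapseTime μ r - t := by linarith
  unfold areaRadius
  positivity

lemma areaRadius_cube (hμ : IsRegularData b μ) {r t : ℝ} (hr : r ∈ Ioo 0 b)
    (ht : t < collapseTime μ r) :
    areaRadius μ r t ^ 3 = 9 / 4 * mass μ r * (collapseTime μ r - t) ^ 2 := by
  have h1 := hμ.mass_pos' hr
  have h2 : 0 < collapseTime μ r - t := by linarith
  unfold areaRadius
  rw [← Real.rpow_natCast, ← Real.rpow_mul (by positivity)]
  norm_num

lemma trapping_pos (hμ : IsRegularData b μ) {r t : ℝ} (hr : r ∈ Ioo 0 b)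
    (ht : t < collapseTime μ r) : 0 < trapping μ r t := by
  have h1 := areaRadius_pos hμ hr ht
  have h2 : 0 < collapseTime μ r - t := by linarith
  unfold trapping
  positivity

lemma trapping_sq (hμ : IsRegularData b μ) {r t : ℝ} (hr : r ∈ Ioo 0 b)
    (ht : t < collapseTime μ r) : trapping μ r t ^ 2 * areaRadius μ r t = mass μ r := by
  have h1 := areaRadius_cube hμ hr ht
  have h2 : 0 < collapseTime μ r - t := by linarith
  unfold trapping
  field_simp
  linear_combination 4 * h1

lemma collapseTime_sub_eq (hμ : IsRegularData b μ) {r t : ℝ} (hr : r ∈ Ioo 0 b)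
    (ht : t < collapseTime μ r) :
    collapseTime μ r - t = 2 / 3 * areaRadius μ r t / trapping μ r t := by
  have h1 := areaRadius_pos hμ hr ht
  have h2 : 0 < collapseTime μ r - t := by linarith
  unfold trapping
  field_simp

/-- Stated along an arbitrary curve, so that one computation yields both partial derivatives (one
coordinate held constant) and the derivative along geodesics. -/
lemma hasDerivAt_areaRadius_comp (hμ : IsRegularData b μ) {r t : ℝ → ℝ} {s r' t' : ℝ}
    (hr : r s ∈ Ioo 0 b) (ht : t s < collapseTime μ (r s)) (hr' : HasDerivAt r r' s)
    (ht' : HasDerivAt t t' s) :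
    HasDerivAt (fun u => areaRadius μ (r u) (t u))
      (areaRadius μ (r s) (t s) * radialLogRate μ (r s) (t s) * r'
        - trapping μ (r s) (t s) * t') s := by
  have h1 := hμ.mass_pos' hr
  have h2 : 0 < collapseTime μ (r s) - t s := by linarith
  have hm := (hasDerivAt_mass hμ hr).comp s hr'
  have hc := (hasDerivAt_collapseTime hμ hr).comp s hr'
  have hW : 0 < 9 / 4 * mass μ (r s) * (collapseTime μ (r s) - t s) ^ 2 := by positivity
  have hd := ((hm.const_mul (9 / 4 : ℝ)).mul ((hc.sub ht').pow 2)).rpow_const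
    (p := (1 : ℝ) / 3) (Or.inl hW.ne')
  refine hd.congr_deriv ?_
  simp only [Pi.mul_apply, Pi.pow_apply, Pi.sub_apply, Function.comp]
  rw [Real.rpow_sub hW, Real.rpow_one]
  change _ * (areaRadius μ (r s) (t s) / _) = _
  unfold radialLogRate trapping massRate
  field_simp
  ring

lemma areaRadius_t_eq (hμ : IsRegularData b μ) {r t : ℝ} (hr : r ∈ Ioo 0 b)
    (ht : t < collapseTime μ r) : areaRadius_t μ r t = - trapping μ r t := by
  have h := hasDerivAt_areaRadius_comp hμ (r := fun _ => r) (t := fun u => u) (s := t) hr ht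
    (hasDerivAt_const t r) (hasDerivAt_id t)
  rw [areaRadius_t, h.deriv]; ring

lemma areaRadius_r_eq (hμ : IsRegularData b μ) {r t : ℝ} (hr : r ∈ Ioo 0 b)
    (ht : t < collapseTime μ r) :
    areaRadius_r μ r t = areaRadius μ r t * radialLogRate μ r t := by
  have h := hasDerivAt_areaRadius_comp hμ (r := fun u => u) (t := fun _ => t) (s := r) hr ht
    (hasDerivAt_id r) (hasDerivAt_const r t)
  rw [areaRadius_r, h.deriv]; ring

lemma eventually_domain (hμ : IsRegularData b μ) {r t : ℝ → ℝ} {s : ℝ}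
    (hr : r s ∈ Ioo 0 b) (ht : t s < collapseTime μ (r s)) (hr' : ContinuousAt r s)
    (ht' : ContinuousAt t s) :
    ∀ᶠ u in 𝓝 s, r u ∈ Ioo 0 b ∧ t u < collapseTime μ (r u) := by
  refine (hr'.eventually (isOpen_Ioo.mem_nhds hr)).and ?_
  exact ht'.eventually_lt ((hasDerivAt_collapseTime hμ hr).continuousAt.comp hr') ht

lemma hasDerivAt_areaRadius_r_comp (hμ : IsRegularData b μ) {r t : ℝ → ℝ} {s r' t' : ℝ}
    (hr : r s ∈ Ioo 0 b) (ht : t s < collapseTime μ (r s)) (hr' : HasDerivAt r r' s)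
    (ht' : HasDerivAt t t' s) :
    HasDerivAt (fun u => areaRadius_r μ (r u) (t u))
      (areaRadius μ (r s) (t s) * (radialLogRate μ (r s) (t s) ^ 2 + deriv (massRate μ) (r s)
          + 2 / 3 * deriv (collapseRate μ) (r s) / (collapseTime μ (r s) - t s)
          - 2 / 3 * collapseRate μ (r s) ^ 2 / (collapseTime μ (r s) - t s) ^ 2) * r'
        + areaRadius μ (r s) (t s) * mixedLogRate μ (r s) (t s) * t') s := by
  have h1 := areaRadius_pos hμ hr ht
  have h2 : 0 < collapseTime μ (r s) - t s := by linarith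
  have hgd := (((contDiffOn_massRate hμ).differentiableOn one_ne_zero).differentiableAt
    (isOpen_Ioo.mem_nhds hr)).hasDerivAt.comp s hr'
  have htd := (((contDiffOn_collapseRate hμ).differentiableOn one_ne_zero).differentiableAt
    (isOpen_Ioo.mem_nhds hr)).hasDerivAt.comp s hr'
  have hcd := (hasDerivAt_collapseTime hμ hr).comp s hr'
  have hd := (hasDerivAt_areaRadius_comp hμ hr ht hr' ht').mul
    (hgd.add ((htd.const_mul (2 / 3 : ℝ)).div (hcd.sub ht') h2.ne'))
  refine (hd.congr_of_eventuallyEq ?_).congr_deriv ?_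
  · filter_upwards [eventually_domain hμ hr ht hr'.continuousAt ht'.continuousAt] with u hu
    rw [areaRadius_r_eq hμ hu.1 hu.2]
    rfl
  · simp only [Pi.add_apply, Pi.sub_apply, Pi.div_apply, Function.comp]
    unfold mixedLogRate radialLogRate trapping
    field_simp
    ring

lemma areaRadius_rt_eq (hμ : IsRegularData b μ) {r t : ℝ} (hr : r ∈ Ioo 0 b)
    (ht : t < collapseTime μ r) :
    areaRadius_rt μ r t = areaRadius μ r t * mixedLogRate μ r t := by
  have h := hasDerivAt_areaRadius_r_comp hμ (r := fun _ => r) (t := fun u => u) (s := t) hr ht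
    (hasDerivAt_const t r) (hasDerivAt_id t)
  rw [areaRadius_rt, h.deriv]; ring

lemma hasDerivAt_areaRadius_r_comp' (hμ : IsRegularData b μ) {r t : ℝ → ℝ} {s r' t' : ℝ}
    (hr : r s ∈ Ioo 0 b) (ht : t s < collapseTime μ (r s)) (hr' : HasDerivAt r r' s)
    (ht' : HasDerivAt t t' s) :
    HasDerivAt (fun u => areaRadius_r μ (r u) (t u))
      (areaRadius_rr μ (r s) (t s) * r' + areaRadius_rt μ (r s) (t s) * t') s := by
  refine (hasDerivAt_areaRadius_r_comp hμ hr ht hr' ht').congr_deriv ?_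
  have h := hasDerivAt_areaRadius_r_comp hμ (r := fun u => u) (t := fun _ => t s) (s := r s) hr ht
    (hasDerivAt_id (r s)) (hasDerivAt_const (r s) (t s))
  rw [areaRadius_rr, h.deriv, areaRadius_rt_eq hμ hr ht]; ring

end Data

section Flow

/-! ### The geodesic flow near the centre -/

/-- A radius below which the density is positive (and which is at most `1`). -/
structure IsCore (b : ℝ) (μ : ℝ → ℝ) (ρ : ℝ) : Prop where
  pos : 0 < ρ
  le_radius : ρ ≤ b
  le_one : ρ ≤ 1
  density_pos : ∀ r ∈ Ioo 0 ρ, 0 < μ r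

/-- `dt/ds` for a geodesic with radial momentum `p = R_{,r} dr/ds`. -/
def energy (μ : ℝ → ℝ) (ε L r t p : ℝ) : ℝ :=
  Real.sqrt (p ^ 2 + ε + L ^ 2 / areaRadius μ r t ^ 2)

/-- The geodesic equations as a first-order system for `(t, r, p)`, with `p = R_{,r} dr/ds`. -/
def geodesicField (μ : ℝ → ℝ) (ε L : ℝ) (z : ℝ × ℝ × ℝ) : ℝ × ℝ × ℝ :=
  (energy μ ε L z.2.1 z.1 z.2.2,
    z.2.2 / (areaRadius μ z.2.1 z.1 * radialLogRate μ z.2.1 z.1),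
    -hubble μ z.2.1 z.1 * z.2.2 * energy μ ε L z.2.1 z.1 z.2.2
      + L ^ 2 / areaRadius μ z.2.1 z.1 ^ 3)

/-- States `(t, r, p)` with `t₀ < t < t_c(r)`, `0 < r < ρ` and `0 < p`. -/
def outgoingRegion (μ : ℝ → ℝ) (ρ : ℝ) : Set (ℝ × ℝ × ℝ) :=
  {z | z.2.1 ∈ Ioo 0 ρ ∧ z.1 < collapseTime μ z.2.1 ∧ centralTime μ < z.1 ∧ 0 < z.2.2}

variable {b : ℝ} {μ : ℝ → ℝ} {ρ : ℝ}

lemma IsCore.mem (hρ : IsCore b μ ρ) {r : ℝ} (hr : r ∈ Ioo 0 ρ) : r ∈ Ioo 0 b :=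
  ⟨hr.1, hr.2.trans_le hρ.le_radius⟩

lemma exists_isCore (hμ : IsRegularData b μ) : ∃ ρ, IsCore b μ ρ := by
  obtain ⟨u, hu, hsub⟩ := mem_nhdsGT_iff_exists_Ioo_subset.1
    ((tendsto_density hμ).eventually (lt_mem_nhds hμ.central_density_pos))
  have hb := hμ.radius_pos
  have hu' : 0 < u := hu
  -- The bound `1` on the radius gives `m < r ≤ 1`, so that powers of `m` can be discarded in the
  -- momentum estimates.
  refine ⟨min u (min b 1), by positivity, ?_, ?_, fun r hr => ?_⟩
  · exact (min_le_right _ _).trans (min_le_left _ _)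
  · exact (min_le_right _ _).trans (min_le_right _ _)
  · exact hsub ⟨hr.1, hr.2.trans_le (min_le_left _ _)⟩

lemma IsCore.mono (hρ : IsCore b μ ρ) {σ : ℝ} (hσ : 0 < σ) (h : σ ≤ ρ) : IsCore b μ σ :=
  ⟨hσ, h.trans hρ.le_radius, h.trans hρ.le_one,
    fun r hr => hρ.density_pos r ⟨hr.1, hr.2.trans_le h⟩⟩

lemma massRate_pos (hμ : IsRegularData b μ) (hρ : IsCore b μ ρ) {r : ℝ} (hr : r ∈ Ioo 0 ρ) :
    0 < massRate μ r := by
  have h1 := hμ.mass_pos' (hρ.mem hr)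
  have h2 := hρ.density_pos r hr
  have h3 := hr.1
  unfold massRate
  positivity

lemma radialLogRate_pos (hμ : IsRegularData b μ) (hρ : IsCore b μ ρ) {r t : ℝ}
    (hr : r ∈ Ioo 0 ρ) (ht : t < collapseTime μ r) : 0 < radialLogRate μ r t := by
  have h1 := massRate_pos hμ hρ hr
  have h2 := collapseRate_pos hμ (hρ.mem hr)
  have h3 : 0 < collapseTime μ r - t := by linarith
  unfold radialLogRate
  positivity

lemma isOpen_outgoingRegion (hμ : IsRegularData b μ) (hρ : IsCore b μ ρ) :
    IsOpen (outgoingRegion μ ρ) := by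
  have h1 : IsOpen {z : ℝ × ℝ × ℝ | z.2.1 ∈ Ioo 0 ρ} :=
    isOpen_Ioo.preimage (continuous_fst.comp continuous_snd)
  have hc : ContinuousOn (fun z : ℝ × ℝ × ℝ => collapseTime μ z.2.1 - z.1)
      {z | z.2.1 ∈ Ioo 0 ρ} := by
    refine ContinuousOn.sub ?_ continuousOn_fst
    exact (contDiffOn_collapseTime hμ).continuousOn.comp
      (continuous_fst.comp continuous_snd).continuousOn fun z hz => hρ.mem hz
  have h2 := hc.isOpen_inter_preimage h1 isOpen_Ioi (t := Ioi 0)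
  have h3 : IsOpen {z : ℝ × ℝ × ℝ | centralTime μ < z.1 ∧ 0 < z.2.2} :=
    (isOpen_lt continuous_const continuous_fst).inter
      (isOpen_lt continuous_const (continuous_snd.comp continuous_snd))
  convert h2.inter h3 using 1
  ext z
  simp [outgoingRegion, and_assoc]

lemma energy_arg_pos {ε L p R : ℝ} (hε : 0 ≤ ε) (hp : 0 < p) : 0 < p ^ 2 + ε + L ^ 2 / R ^ 2 := by
  positivity

lemma contDiffOn_geodesicField (hμ : IsRegularData b μ) (hρ : IsCore b μ ρ) {ε L : ℝ}
    (hε : 0 ≤ ε) : ContDiffOn ℝ 1 (geodesicField μ ε L) (outgoingRegion μ ρ) := by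
  have hr : ContDiffOn ℝ 1 (fun z : ℝ × ℝ × ℝ => z.2.1) (outgoingRegion μ ρ) :=
    (contDiff_fst.comp contDiff_snd).contDiffOn
  have ht : ContDiffOn ℝ 1 (fun z : ℝ × ℝ × ℝ => z.1) (outgoingRegion μ ρ) :=
    contDiff_fst.contDiffOn
  have hp : ContDiffOn ℝ 1 (fun z : ℝ × ℝ × ℝ => z.2.2) (outgoingRegion μ ρ) :=
    (contDiff_snd.comp contDiff_snd).contDiffOn
  have hmaps : MapsTo (fun z : ℝ × ℝ × ℝ => z.2.1) (outgoingRegion μ ρ) (Ioo 0 b) :=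
    fun z hz => hρ.mem hz.1
  have hm := (contDiffOn_mass hμ).comp hr hmaps
  have hc := (contDiffOn_collapseTime hμ).comp hr hmaps
  have hg := (contDiffOn_massRate hμ).comp hr hmaps
  have hk := (contDiffOn_collapseRate hμ).comp hr hmaps
  have hy := hc.sub ht
  have hy0 : ∀ z ∈ outgoingRegion μ ρ, 0 < collapseTime μ z.2.1 - z.1 := fun z hz => by
    linarith [hz.2.1]
  have hR : ContDiffOn ℝ 1 (fun z : ℝ × ℝ × ℝ => areaRadius μ z.2.1 z.1) (outgoingRegion μ ρ) := by
    refine ContDiffOn.rpow_const_of_ne ((contDiffOn_const.mul hm).mul (hy.pow 2)) fun z hz => ?_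
    have h1 := hμ.mass_pos' (hρ.mem hz.1)
    have h2 := hy0 z hz
    exact ne_of_gt (mul_pos (mul_pos (by norm_num) h1) (pow_pos h2 2))
  have hR0 : ∀ z ∈ outgoingRegion μ ρ, 0 < areaRadius μ z.2.1 z.1 := fun z hz =>
    areaRadius_pos hμ (hρ.mem hz.1) hz.2.1
  have hq : ContDiffOn ℝ 1 (fun z : ℝ × ℝ × ℝ => radialLogRate μ z.2.1 z.1)
      (outgoingRegion μ ρ) :=
    hg.add ((contDiffOn_const.mul hk).div hy fun z hz => (hy0 z hz).ne')
  have hq0 : ∀ z ∈ outgoingRegion μ ρ, 0 < radialLogRate μ z.2.1 z.1 := fun z hz =>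
    radialLogRate_pos hμ hρ hz.1 hz.2.1
  have hN : ContDiffOn ℝ 1 (fun z : ℝ × ℝ × ℝ => mixedLogRate μ z.2.1 z.1)
      (outgoingRegion μ ρ) :=
    ((contDiffOn_const.mul hg).div hy fun z hz => (hy0 z hz).ne').add
      ((contDiffOn_const.mul hk).div (hy.pow 2) fun z hz => (pow_pos (hy0 z hz) 2).ne')
  have hH : ContDiffOn ℝ 1 (fun z : ℝ × ℝ × ℝ => hubble μ z.2.1 z.1) (outgoingRegion μ ρ) :=
    hN.div hq fun z hz => (hq0 z hz).ne'
  have hE : ContDiffOn ℝ 1 (fun z : ℝ × ℝ × ℝ => energy μ ε L z.2.1 z.1 z.2.2)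
      (outgoingRegion μ ρ) := by
    refine ContDiffOn.sqrt (((hp.pow 2).add contDiffOn_const).add
      (contDiffOn_const.div (hR.pow 2) fun z hz => (pow_pos (hR0 z hz) 2).ne')) fun z hz => ?_
    exact (energy_arg_pos hε hz.2.2.2).ne'
  refine hE.prodMk ((hp.div (hR.mul hq) fun z hz => (mul_pos (hR0 z hz) (hq0 z hz)).ne').prodMk ?_)
  exact ((hH.neg.mul hp).mul hE).add
    (contDiffOn_const.div (hR.pow 3) fun z hz => (pow_pos (hR0 z hz) 3).ne')

/-- Solutions of the first-order system on `(0, T]`. -/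
def IsFlowLine (μ : ℝ → ℝ) (ρ ε L T : ℝ) (z : ℝ → ℝ × ℝ × ℝ) : Prop :=
  ∀ s ∈ Ioc 0 T, z s ∈ outgoingRegion μ ρ ∧ HasDerivAt z (geodesicField μ ε L (z s)) s

lemma exists_flowLine (hμ : IsRegularData b μ) (hρ : IsCore b μ ρ) {ε L : ℝ} (hε : 0 ≤ ε)
    {z₁ : ℝ × ℝ × ℝ} (hz : z₁ ∈ outgoingRegion μ ρ) {B : ℝ} (hB : 0 < B) :
    ∃ T ∈ Ioc 0 B, ∃ z : ℝ → ℝ × ℝ × ℝ, z T = z₁ ∧ IsFlowLine μ ρ ε L T z ∧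
      (T = B ∨ ∀ K ⊆ outgoingRegion μ ρ, IsCompact K → ∃ s ∈ Ioc 0 T, z s ∉ K) :=
  exists_backward_maximal_solution (isOpen_outgoingRegion hμ hρ)
    (contDiffOn_geodesicField hμ hρ hε) hz hB

section FlowLine

variable {ε L T : ℝ} {z : ℝ → ℝ × ℝ × ℝ}

lemma IsFlowLine.hasDerivAt_t (hz : IsFlowLine μ ρ ε L T z) {s : ℝ} (hs : s ∈ Ioc 0 T) :
    HasDerivAt (fun u => (z u).1) (energy μ ε L (z s).2.1 (z s).1 (z s).2.2) s :=
  (ContinuousLinearMap.fst ℝ ℝ (ℝ × ℝ)).hasFDerivAt.comp_hasDerivAt s (hz s hs).2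

lemma IsFlowLine.hasDerivAt_r (hz : IsFlowLine μ ρ ε L T z) {s : ℝ} (hs : s ∈ Ioc 0 T) :
    HasDerivAt (fun u => (z u).2.1)
      ((z s).2.2 / (areaRadius μ (z s).2.1 (z s).1 * radialLogRate μ (z s).2.1 (z s).1)) s :=
  (ContinuousLinearMap.fst ℝ ℝ ℝ).hasFDerivAt.comp_hasDerivAt s
    ((ContinuousLinearMap.snd ℝ ℝ (ℝ × ℝ)).hasFDerivAt.comp_hasDerivAt s (hz s hs).2)

lemma IsFlowLine.hasDerivAt_p (hz : IsFlowLine μ ρ ε L T z) {s : ℝ} (hs : s ∈ Ioc 0 T) :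
    HasDerivAt (fun u => (z u).2.2)
      (-hubble μ (z s).2.1 (z s).1 * (z s).2.2 * energy μ ε L (z s).2.1 (z s).1 (z s).2.2
        + L ^ 2 / areaRadius μ (z s).2.1 (z s).1 ^ 3) s :=
  (ContinuousLinearMap.snd ℝ ℝ ℝ).hasFDerivAt.comp_hasDerivAt s
    ((ContinuousLinearMap.snd ℝ ℝ (ℝ × ℝ)).hasFDerivAt.comp_hasDerivAt s (hz s hs).2)

lemma energy_sq {R p : ℝ} {r t : ℝ} (hε : 0 ≤ ε) (hR : areaRadius μ r t = R) :
    energy μ ε L r t p ^ 2 = p ^ 2 + ε + L ^ 2 / R ^ 2 := by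
  rw [energy, hR, Real.sq_sqrt (by positivity)]

lemma le_energy {r t p : ℝ} (hε : 0 ≤ ε) : p ≤ energy μ ε L r t p := by
  refine Real.le_sqrt_of_sq_le ?_
  have : 0 ≤ L ^ 2 / areaRadius μ r t ^ 2 := by positivity
  linarith

lemma energy_pos {r t p : ℝ} (hε : 0 ≤ ε) (hp : 0 < p) : 0 < energy μ ε L r t p :=
  hp.trans_le (le_energy hε)

lemma IsFlowLine.hasDerivAt_areaRadius (hμ : IsRegularData b μ) (hρ : IsCore b μ ρ)
    (hz : IsFlowLine μ ρ ε L T z) {s : ℝ} (hs : s ∈ Ioc 0 T) :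
    HasDerivAt (fun u => areaRadius μ (z u).2.1 (z u).1)
      ((z s).2.2 - trapping μ (z s).2.1 (z s).1
        * energy μ ε L (z s).2.1 (z s).1 (z s).2.2) s := by
  have hm := (hz s hs).1
  refine (hasDerivAt_areaRadius_comp hμ (r := fun u => (z u).2.1) (t := fun u => (z u).1)
    (hρ.mem hm.1) hm.2.1 (hz.hasDerivAt_r hs) (hz.hasDerivAt_t hs)).congr_deriv ?_
  have h1 := areaRadius_pos hμ (hρ.mem hm.1) hm.2.1
  have h2 := radialLogRate_pos hμ hρ hm.1 hm.2.1
  field_simp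

/-- The system contains only the `r`-equation and the norm condition, through `E`. Differentiating
`E` recovers the second-order equation for `t`. -/
lemma IsFlowLine.hasDerivAt_energy (hμ : IsRegularData b μ) (hρ : IsCore b μ ρ) (hε : 0 ≤ ε)
    (hz : IsFlowLine μ ρ ε L T z) {s : ℝ} (hs : s ∈ Ioc 0 T) :
    HasDerivAt (fun u => energy μ ε L (z u).2.1 (z u).1 (z u).2.2)
      (-hubble μ (z s).2.1 (z s).1 * (z s).2.2 ^ 2 + trapping μ (z s).2.1 (z s).1
        * (L ^ 2 / areaRadius μ (z s).2.1 (z s).1 ^ 3)) s := by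
  have hm := (hz s hs).1
  have h1 := areaRadius_pos hμ (hρ.mem hm.1) hm.2.1
  have hE := energy_pos (μ := μ) (L := L) (r := (z s).2.1) (t := (z s).1) hε hm.2.2.2
  have hd := ((((hz.hasDerivAt_p hs).pow 2).add_const ε).add
    ((hasDerivAt_const s (L ^ 2)).div ((hz.hasDerivAt_areaRadius hμ hρ hs).pow 2)
      (pow_pos h1 2).ne')).sqrt (energy_arg_pos hε hm.2.2.2).ne'
  refine hd.congr_deriv ?_
  simp only [Pi.add_apply, Pi.pow_apply, Pi.div_apply]
  change _ / (2 * energy μ ε L (z s).2.1 (z s).1 (z s).2.2) = _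
  generalize energy μ ε L (z s).2.1 (z s).1 (z s).2.2 = E at *
  generalize areaRadius μ (z s).2.1 (z s).1 = R at *
  field_simp
  ring

/-- A function with nonnegative derivative and finite limits at both ends has an integrable
derivative; the limit at `0` supplies the continuous extension to `[0, T]`. -/
lemma integrableOn_deriv_of_tendsto {f f' : ℝ → ℝ} {a : ℝ} (hT : 0 < T)
    (hd : ∀ s ∈ Ioc 0 T, HasDerivAt f (f' s) s) (hf : ∀ s ∈ Ioc 0 T, 0 ≤ f' s)
    (ha : Tendsto f (𝓝[>] 0) (𝓝 a)) : IntegrableOn (deriv f) (Ioo 0 T) := by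
  have hcont : ContinuousOn (extendFrom (Ioo 0 T) f) (Icc 0 T) := by
    have hc : ContinuousOn f (Ioo 0 T) :=
      HasDerivAt.continuousOn fun s hs => hd s (Ioo_subset_Ioc_self hs)
    have hcT : Tendsto f (𝓝[<] T) (𝓝 (f T)) :=
      (hd T ⟨hT, le_rfl⟩).continuousAt.tendsto.mono_left nhdsWithin_le_nhds
    exact continuousOn_Icc_extendFrom_Ioo hc ha hcT
  have hfc : ∀ s ∈ Ioo 0 T, HasDerivAt (extendFrom (Ioo 0 T) f) (f' s) s := by
    intro s hs
    refine (hd s (Ioo_subset_Ioc_self hs)).congr_of_eventuallyEq ?_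
    filter_upwards [isOpen_Ioo.mem_nhds hs] with u hu
    refine extendFrom_eq (subset_closure hu) ?_
    exact ((hd u (Ioo_subset_Ioc_self hu)).continuousAt.tendsto).mono_left nhdsWithin_le_nhds
  have h := intervalIntegral.integrableOn_deriv_of_nonneg hcont hfc
    fun s hs => hf s (Ioo_subset_Ioc_self hs)
  refine (h.mono_set Ioo_subset_Ioc_self).congr_fun (fun s hs => ?_) measurableSet_Ioo
  exact (hd s (Ioo_subset_Ioc_self hs)).deriv.symm

/-- Bootstrap: a solution of a `C¹` field is `C¹`, hence its derivative is `C¹` as well. -/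
lemma IsFlowLine.contDiffOn (hμ : IsRegularData b μ) (hρ : IsCore b μ ρ) (hε : 0 ≤ ε)
    (hz : IsFlowLine μ ρ ε L T z) : ContDiffOn ℝ 2 z (Ioo 0 T) := by
  have hmaps : MapsTo z (Ioo 0 T) (outgoingRegion μ ρ) :=
    fun s hs => (hz s (Ioo_subset_Ioc_self hs)).1
  have hd : ∀ s ∈ Ioo 0 T, deriv z s = geodesicField μ ε L (z s) := fun s hs =>
    (hz s (Ioo_subset_Ioc_self hs)).2.deriv
  have hdiff : DifferentiableOn ℝ z (Ioo 0 T) := fun s hs =>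
    (hz s (Ioo_subset_Ioc_self hs)).2.differentiableAt.differentiableWithinAt
  have hf := contDiffOn_geodesicField hμ hρ (L := L) hε
  have h1 : ContDiffOn ℝ 1 z (Ioo 0 T) := by
    rw [show (1 : WithTop ℕ∞) = 0 + 1 by norm_num, contDiffOn_succ_iff_deriv_of_isOpen isOpen_Ioo]
    refine ⟨hdiff, fun h => by simp at h, contDiffOn_zero.2 ?_⟩
    exact (hf.continuousOn.comp hdiff.continuousOn hmaps).congr hd
  rw [show (2 : WithTop ℕ∞) = 1 + 1 by norm_num, contDiffOn_succ_iff_deriv_of_isOpen isOpen_Ioo]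
  exact ⟨hdiff, fun h => by simp at h, (hf.comp h1 hmaps).congr hd⟩

/-- A flow line that starts at the singularity is a geodesic that emanates from it. -/
lemma IsFlowLine.emanates (hμ : IsRegularData b μ) (hρ : IsCore b μ ρ) (hε : 0 ≤ ε) (hT : 0 < T)
    (hz : IsFlowLine μ ρ ε L T z) (ht : Tendsto (fun s => (z s).1) (𝓝[>] 0) (𝓝 (centralTime μ)))
    (hr : Tendsto (fun s => (z s).2.1) (𝓝[>] 0) (𝓝 0)) : Emanates b μ ε L := by
  have hsub : Ioo 0 T ⊆ Ioc 0 T := Ioo_subset_Ioc_self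
  have hm : ∀ s ∈ Ioc 0 T, z s ∈ outgoingRegion μ ρ := fun s hs => (hz s hs).1
  have hdt : ∀ s ∈ Ioo 0 T, deriv (fun u => (z u).1) s
      = energy μ ε L (z s).2.1 (z s).1 (z s).2.2 := fun s hs => (hz.hasDerivAt_t (hsub hs)).deriv
  have hdr : ∀ s ∈ Ioo 0 T, deriv (fun u => (z u).2.1) s
      = (z s).2.2 / areaRadius_r μ (z s).2.1 (z s).1 := fun s hs => by
    have h := hm s (hsub hs)
    rw [(hz.hasDerivAt_r (hsub hs)).deriv, areaRadius_r_eq hμ (hρ.mem h.1) h.2.1]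
  have hRr : ∀ s ∈ Ioo 0 T, 0 < areaRadius_r μ (z s).2.1 (z s).1 := fun s hs => by
    have h := hm s (hsub hs)
    rw [areaRadius_r_eq hμ (hρ.mem h.1) h.2.1]
    exact mul_pos (areaRadius_pos hμ (hρ.mem h.1) h.2.1) (radialLogRate_pos hμ hρ h.1 h.2.1)
  have hrt : ∀ s ∈ Ioo 0 T, areaRadius_rt μ (z s).2.1 (z s).1
      = hubble μ (z s).2.1 (z s).1 * areaRadius_r μ (z s).2.1 (z s).1 := fun s hs => by
    have h := hm s (hsub hs)
    have h2 := radialLogRate_pos hμ hρ h.1 h.2.1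
    rw [areaRadius_r_eq hμ (hρ.mem h.1) h.2.1, areaRadius_rt_eq hμ (hρ.mem h.1) h.2.1, hubble]
    field_simp
  refine ⟨T, fun s => (z s).1, fun s => (z s).2.1, hT, ⟨?_, ?_, ?_, ?_, ?_, ?_, ?_⟩, ?_, ?_, ?_,
    hr, ht⟩
  · exact contDiff_fst.comp_contDiffOn (hz.contDiffOn hμ hρ hε)
  · exact contDiff_fst.comp_contDiffOn (contDiff_snd.comp_contDiffOn (hz.contDiffOn hμ hρ hε))
  · exact fun s hs => hρ.mem (hm s (hsub hs)).1
  · exact fun s hs => ⟨(centralTime_pos hμ).le.trans (hm s (hsub hs)).2.2.1.le,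
      (hm s (hsub hs)).2.1⟩
  · intro s hs
    have h := hm s (hsub hs)
    have e : deriv (deriv fun u => (z u).1) s = _ :=
      (((hz.hasDerivAt_energy hμ hρ hε (hsub hs)).congr_of_eventuallyEq
        (by filter_upwards [isOpen_Ioo.mem_nhds hs] with u hu using hdt u hu))).deriv
    rw [e, hdr s hs, hrt s hs, areaRadius_t_eq hμ (hρ.mem h.1) h.2.1]
    have := hRr s hs
    field_simp
    ring
  · intro s hs
    have h := hm s (hsub hs)
    have h0 := hRr s hs
    have hd := (hz.hasDerivAt_p (hsub hs)).div (hasDerivAt_areaRadius_r_comp' hμ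
      (r := fun u => (z u).2.1) (t := fun u => (z u).1) (hρ.mem h.1) h.2.1
      (hz.hasDerivAt_r (hsub hs)) (hz.hasDerivAt_t (hsub hs))) h0.ne'
    have e : deriv (deriv fun u => (z u).2.1) s = _ :=
      (hd.congr_of_eventuallyEq
        (by filter_upwards [isOpen_Ioo.mem_nhds hs] with u hu using hdr u hu)).deriv
    rw [e, hdr s hs, hdt s hs, ← areaRadius_r_eq hμ (hρ.mem h.1) h.2.1, hrt s hs]
    have hR := areaRadius_pos hμ (hρ.mem h.1) h.2.1
    field_simp
    ring
  · intro s hs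
    have h := hm s (hsub hs)
    have h0 := hRr s hs
    rw [hdt s hs, hdr s hs, energy_sq hε rfl]
    field_simp
    ring
  · intro s hs
    rw [hdt s hs]
    exact Real.sqrt_nonneg _
  · exact integrableOn_deriv_of_tendsto hT (fun s hs => hz.hasDerivAt_t hs)
      (fun s hs => Real.sqrt_nonneg _) ht
  · refine integrableOn_deriv_of_tendsto hT (fun s hs => hz.hasDerivAt_r hs) (fun s hs => ?_) hr
    have h := hm s hs
    exact (div_pos h.2.2.2 (mul_pos (areaRadius_pos hμ (hρ.mem h.1) h.2.1)
      (radialLogRate_pos hμ hρ h.1 h.2.1))).le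

end FlowLine

end Flow

section Untrapped

/-! ### Untrapped flow lines -/

lemma monotoneOn_Ioc_of_hasDerivAt {T : ℝ} {f f' : ℝ → ℝ}
    (hd : ∀ s ∈ Ioc 0 T, HasDerivAt f (f' s) s) (h : ∀ s ∈ Ioc 0 T, 0 ≤ f' s) :
    MonotoneOn f (Ioc 0 T) := by
  refine monotoneOn_of_deriv_nonneg (convex_Ioc 0 T) (HasDerivAt.continuousOn hd) ?_ ?_
  · rw [interior_Ioc]
    exact fun s hs => (hd s (Ioo_subset_Ioc_self hs)).differentiableAt.differentiableWithinAt
  · rw [interior_Ioc]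
    intro s hs
    rw [(hd s (Ioo_subset_Ioc_self hs)).deriv]
    exact h s (Ioo_subset_Ioc_self hs)

variable {b : ℝ} {μ : ℝ → ℝ} {ρ : ℝ} {ε L T : ℝ} {z : ℝ → ℝ × ℝ × ℝ}

/-- With `x = √(m/R)` one has `t_c - t = (2/3) R/x` and `m = x² R`, so `t_c - t > (2/3) m` amounts
to `x³ < 1`. The gap `(2/3) m` thus marks the apparent horizon `R = m`. -/
lemma trapping_lt_one (hμ : IsRegularData b μ) {r t : ℝ} (hr : r ∈ Ioo 0 b)
    (h : 2 / 3 * mass μ r < collapseTime μ r - t) : trapping μ r t < 1 := by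
  have hm := hμ.mass_pos' hr
  have ht : t < collapseTime μ r := by linarith
  have h1 := trapping_pos hμ hr ht
  have h2 := trapping_sq hμ hr ht
  have h3 := areaRadius_pos hμ hr ht
  rw [collapseTime_sub_eq hμ hr ht, lt_div_iff₀ h1] at h
  by_contra! hx
  nlinarith [mul_le_mul hx hx zero_le_one h1.le, mul_pos h3 h1]

lemma mass_lt_areaRadius (hμ : IsRegularData b μ) {r t : ℝ} (hr : r ∈ Ioo 0 b)
    (h : 2 / 3 * mass μ r < collapseTime μ r - t) : mass μ r < areaRadius μ r t := by
  have hm := hμ.mass_pos' hr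
  have ht : t < collapseTime μ r := by linarith
  have h1 := trapping_pos hμ hr ht
  have h2 := trapping_sq hμ hr ht
  have h3 := areaRadius_pos hμ hr ht
  have h4 := trapping_lt_one hμ hr h
  nlinarith [mul_pos h1 h3, mul_pos (sub_pos.2 h4) h3]

lemma areaRadius_eq_mass (hμ : IsRegularData b μ) {r t : ℝ} (hr : r ∈ Ioo 0 b)
    (h : collapseTime μ r - t = 2 / 3 * mass μ r) : areaRadius μ r t = mass μ r := by
  have hm := hμ.mass_pos' hr
  have ht : t < collapseTime μ r := by linarith
  have h1 := areaRadius_cube hμ hr ht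
  have h2 : areaRadius μ r t ^ 3 = mass μ r ^ 3 := by rw [h1, h]; ring
  exact (pow_left_inj₀ (areaRadius_pos hμ hr ht).le hm.le (by norm_num)).1 h2

lemma strictMonoOn_mass (hμ : IsRegularData b μ) (hρ : IsCore b μ ρ) :
    StrictMonoOn (mass μ) (Ioo 0 ρ) := by
  refine strictMonoOn_of_deriv_pos (convex_Ioo 0 ρ)
    (HasDerivAt.continuousOn fun r hr => hasDerivAt_mass hμ (hρ.mem hr)) fun r hr => ?_
  rw [interior_Ioo] at hr
  rw [(hasDerivAt_mass hμ (hρ.mem hr)).deriv]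
  have := hρ.density_pos r hr
  have := hr.1
  positivity

lemma mass_le_one (hμ : IsRegularData b μ) (hρ : IsCore b μ ρ) {r : ℝ} (hr : r ∈ Ioo 0 ρ) :
    mass μ r ≤ 1 := by
  have h1 := hμ.no_trapped r (Ioo_subset_Ioc_self (hρ.mem hr))
  have h2 := hρ.le_one
  linarith [hr.2]

lemma IsFlowLine.hasDerivAt_gap (hμ : IsRegularData b μ) (hρ : IsCore b μ ρ)
    (hz : IsFlowLine μ ρ ε L T z) {s : ℝ} (hs : s ∈ Ioc 0 T) :
    HasDerivAt (fun u => collapseTime μ (z u).2.1 - (z u).1)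
      (collapseRate μ (z s).2.1 * ((z s).2.2
          / (areaRadius μ (z s).2.1 (z s).1 * radialLogRate μ (z s).2.1 (z s).1))
        - energy μ ε L (z s).2.1 (z s).1 (z s).2.2) s :=
  have h : HasDerivAt (collapseTime μ ∘ fun u => (z u).2.1) _ s :=
    (hasDerivAt_collapseTime hμ (hρ.mem (hz s hs).1.1)).comp s (hz.hasDerivAt_r hs)
  h.sub (hz.hasDerivAt_t hs)

/-- Followed backwards, an untrapped flow line stays untrapped. -/
lemma IsFlowLine.untrapped (hμ : IsRegularData b μ) (hρ : IsCore b μ ρ) (hε : 0 ≤ ε)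
    (hz : IsFlowLine μ ρ ε L T z)
    (hT : 2 / 3 * mass μ (z T).2.1 < collapseTime μ (z T).2.1 - (z T).1) :
    ∀ s ∈ Ioc 0 T, 2 / 3 * mass μ (z s).2.1 < collapseTime μ (z s).2.1 - (z s).1 := by
  have key := pos_of_deriv_neg_at_zeros (T := T)
    (h := fun u => collapseTime μ (z u).2.1 - (z u).1 - 2 / 3 * mass μ (z u).2.1)
    (h' := fun s => _) (fun s hs => (hz.hasDerivAt_gap hμ hρ hs).sub
      (((hasDerivAt_mass hμ (hρ.mem (hz s hs).1.1)).comp s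
        (hz.hasDerivAt_r hs)).const_mul (2 / 3 : ℝ))) (by linarith) ?_
  · intro s hs
    linarith [key s hs]
  · intro s hs h0 _
    have hm := (hz s (Ioo_subset_Ioc_self hs)).1
    have hr := hρ.mem hm.1
    have h0' : collapseTime μ (z s).2.1 - (z s).1 = 2 / 3 * mass μ (z s).2.1 := by linarith
    have hR := areaRadius_eq_mass hμ hr h0'
    have hE := le_energy (μ := μ) (L := L) (r := (z s).2.1) (t := (z s).1) (p := (z s).2.2) hε
    have hmp := hμ.mass_pos' hr
    have hτ := collapseRate_pos hμ hr
    have hd := hρ.density_pos _ hm.1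
    have hr0 := hr.1
    have hp := hm.2.2.2
    -- On `R = m` the factor `R_{,r}` equals `w/3 + t_c'` with `w = m' > 0`. Since `E ≥ p`, the
    -- derivative of `t_c - t - (2/3) m` is then at most `-w p / (w/3 + t_c') < 0`.
    have hq : mass μ (z s).2.1 * radialLogRate μ (z s).2.1 (z s).1
        = (z s).2.1 ^ 2 * μ (z s).2.1 / 3 + collapseRate μ (z s).2.1 := by
      unfold radialLogRate massRate
      rw [h0']
      field_simp
    rw [hR, hq]
    generalize energy μ ε L (z s).2.1 (z s).1 (z s).2.2 = E at *
    generalize collapseRate μ (z s).2.1 = τ at *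
    generalize (z s).2.2 = p at *
    have hw : 0 < (z s).2.1 ^ 2 * μ (z s).2.1 := by positivity
    generalize (z s).2.1 ^ 2 * μ (z s).2.1 = w at *
    have : τ * (p / (w / 3 + τ)) - 2 / 3 * (w * (p / (w / 3 + τ))) < p := by
      rw [← sub_neg]
      have : τ * (p / (w / 3 + τ)) - 2 / 3 * (w * (p / (w / 3 + τ))) - p
        = -(w * p) / (w / 3 + τ) := by field_simp; ring
      rw [this]
      exact div_neg_of_neg_of_pos (by nlinarith [mul_pos hw hp]) (by positivity)
    linarith

lemma IsFlowLine.hasDerivAt_trapping (hμ : IsRegularData b μ) (hρ : IsCore b μ ρ)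
    (hz : IsFlowLine μ ρ ε L T z) {s : ℝ} (hs : s ∈ Ioc 0 T) :
    HasDerivAt (fun u => trapping μ (z u).2.1 (z u).1)
      (-hubble μ (z s).2.1 (z s).1 * (z s).2.2
        + trapping μ (z s).2.1 (z s).1 ^ 2 / (2 * areaRadius μ (z s).2.1 (z s).1)
          * energy μ ε L (z s).2.1 (z s).1 (z s).2.2) s := by
  have hm := (hz s hs).1
  have hr := hρ.mem hm.1
  have h1 := areaRadius_pos hμ hr hm.2.1
  have h2 := radialLogRate_pos hμ hρ hm.1 hm.2.1
  have h3 : 0 < collapseTime μ (z s).2.1 - (z s).1 := by linarith [hm.2.1]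
  have hd := ((hz.hasDerivAt_areaRadius hμ hρ hs).const_mul (2 / 3 : ℝ)).div
    (hz.hasDerivAt_gap hμ hρ hs) h3.ne'
  refine hd.congr_deriv ?_
  have hq : massRate μ (z s).2.1 = radialLogRate μ (z s).2.1 (z s).1
      - 2 / 3 * collapseRate μ (z s).2.1 / (collapseTime μ (z s).2.1 - (z s).1) := by
    unfold radialLogRate; ring
  simp only [hubble, mixedLogRate, trapping]
  rw [hq]
  generalize radialLogRate μ (z s).2.1 (z s).1 = q at *
  generalize collapseTime μ (z s).2.1 - (z s).1 = y at *
  generalize areaRadius μ (z s).2.1 (z s).1 = R at *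
  generalize energy μ ε L (z s).2.1 (z s).1 (z s).2.2 = E at *
  field_simp
  ring

/-- Both `log (E + p)` and `x = √(m/R)` change at the rate `-H p` plus lower terms, where `H =
R_{,rt}/R_{,r}`. Subtracting removes `H`, for which no bound is available near the singularity. -/
lemma IsFlowLine.hasDerivAt_log_energy_add (hμ : IsRegularData b μ) (hρ : IsCore b μ ρ)
    (hε : 0 ≤ ε) (hz : IsFlowLine μ ρ ε L T z) {s : ℝ} (hs : s ∈ Ioc 0 T) :
    HasDerivAt (fun u => Real.log (energy μ ε L (z u).2.1 (z u).1 (z u).2.2 + (z u).2.2)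
        - trapping μ (z u).2.1 (z u).1)
      ((1 + trapping μ (z s).2.1 (z s).1) * (L ^ 2 / areaRadius μ (z s).2.1 (z s).1 ^ 3)
          / (energy μ ε L (z s).2.1 (z s).1 (z s).2.2 + (z s).2.2)
        - trapping μ (z s).2.1 (z s).1 ^ 2 / (2 * areaRadius μ (z s).2.1 (z s).1)
          * energy μ ε L (z s).2.1 (z s).1 (z s).2.2) s := by
  have hm := (hz s hs).1
  have hp := hm.2.2.2
  have hE := energy_pos (μ := μ) (L := L) (r := (z s).2.1) (t := (z s).1) hε hp
  have hd := (((hz.hasDerivAt_energy hμ hρ hε hs).add (hz.hasDerivAt_p hs)).log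
    (add_pos hE hp).ne').sub (hz.hasDerivAt_trapping hμ hρ hs)
  refine hd.congr_deriv ?_
  simp only [Pi.add_apply]
  have hne := (add_pos hE hp).ne'
  generalize energy μ ε L (z s).2.1 (z s).1 (z s).2.2 = E at *
  generalize areaRadius μ (z s).2.1 (z s).1 = R at *
  generalize L ^ 2 / R ^ 3 = l at *
  generalize trapping μ (z s).2.1 (z s).1 ^ 2 / (2 * R) * E = w at *
  field_simp
  ring

lemma IsFlowLine.monotoneOn_r (hμ : IsRegularData b μ) (hρ : IsCore b μ ρ)
    (hz : IsFlowLine μ ρ ε L T z) : MonotoneOn (fun s => (z s).2.1) (Ioc 0 T) := by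
  refine monotoneOn_Ioc_of_hasDerivAt (fun s hs => hz.hasDerivAt_r hs) fun s hs => ?_
  have h := (hz s hs).1
  exact (div_pos h.2.2.2 (mul_pos (areaRadius_pos hμ (hρ.mem h.1) h.2.1)
    (radialLogRate_pos hμ hρ h.1 h.2.1))).le

lemma IsFlowLine.monotoneOn_t (hz : IsFlowLine μ ρ ε L T z) :
    MonotoneOn (fun s => (z s).1) (Ioc 0 T) :=
  monotoneOn_Ioc_of_hasDerivAt (fun _ hs => hz.hasDerivAt_t hs) fun _ _ => Real.sqrt_nonneg _

/-- For `ε = L = 0` one has `E = p`, and `log (2p) - x` is nonincreasing. As `0 < x < 1`, going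
backwards costs at most a factor `e` in `p`. -/
lemma IsFlowLine.momentum_bound_of_null (hμ : IsRegularData b μ) (hρ : IsCore b μ ρ)
    (hz : IsFlowLine μ ρ 0 0 T z) (hT : 0 < T)
    (hu : ∀ s ∈ Ioc 0 T, 2 / 3 * mass μ (z s).2.1 < collapseTime μ (z s).2.1 - (z s).1) :
    ∀ s ∈ Ioc 0 T, (z T).2.2 * Real.exp (-1) ≤ (z s).2.2 := by
  have hmono := monotoneOn_Ioc_of_hasDerivAt (fun s hs =>
    (hz.hasDerivAt_log_energy_add hμ hρ le_rfl hs).neg) fun s hs => by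
      have hm := (hz s hs).1
      have h1 := areaRadius_pos hμ (hρ.mem hm.1) hm.2.1
      have h2 := energy_pos (μ := μ) (L := 0) (r := (z s).2.1) (t := (z s).1) le_rfl hm.2.2.2
      have : 0 ≤ trapping μ (z s).2.1 (z s).1 ^ 2 / (2 * areaRadius μ (z s).2.1 (z s).1)
          * energy μ 0 0 (z s).2.1 (z s).1 (z s).2.2 := by positivity
      simp only [ne_eq, OfNat.ofNat_ne_zero, not_false_eq_true, zero_pow, zero_div, mul_zero,
        zero_sub, neg_neg]
      exact this
  have hE : ∀ s ∈ Ioc 0 T, energy μ 0 0 (z s).2.1 (z s).1 (z s).2.2 = (z s).2.2 := fun s hs => by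
    have := (hz s hs).1.2.2.2
    simp [energy, Real.sqrt_sq this.le]
  intro s hs
  have hTm : T ∈ Ioc 0 T := ⟨hT, le_rfl⟩
  have h := hmono hs hTm hs.2
  simp only [Pi.neg_apply, hE s hs, hE T hTm] at h
  have hp := (hz s hs).1.2.2.2
  have hpT := (hz T hTm).1.2.2.2
  have h1 := trapping_pos hμ (hρ.mem (hz s hs).1.1) (hz s hs).1.2.1
  have h2 := trapping_lt_one hμ (hρ.mem (hz T hTm).1.1) (hu T hTm)
  rw [← two_mul, ← two_mul, Real.log_mul (by norm_num) hp.ne',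
    Real.log_mul (by norm_num) hpT.ne'] at h
  rw [← Real.exp_log hp, ← Real.exp_log hpT, ← Real.exp_add, Real.exp_le_exp]
  linarith

/-- Since `t_c(r) → t₀`, shells that have not collapsed at a time `t > t₀` stay away from the
centre. -/
lemma exists_collapseTime_lt (hμ : IsRegularData b μ) (hρ : IsCore b μ ρ) {t : ℝ}
    (ht : centralTime μ < t) : ∃ σ ∈ Ioo 0 ρ, ∀ r ∈ Ioo 0 ρ, t < collapseTime μ r → σ ≤ r := by
  obtain ⟨u, hu, hsub⟩ := mem_nhdsGT_iff_exists_Ioo_subset.1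
    ((tendsto_collapseTime hμ).eventually (gt_mem_nhds ht))
  have hu' : 0 < u := hu
  have hρ0 := hρ.pos
  refine ⟨min u (ρ / 2), ⟨by positivity, (min_le_right _ _).trans_lt (by linarith)⟩,
    fun r hr htr => ?_⟩
  by_contra! h
  have : collapseTime μ r < t := hsub ⟨hr.1, h.trans_le (min_le_left _ _)⟩
  linarith

/-- A maximal untrapped flow line with momentum bounded below starts at `t = t₀`. -/
lemma IsFlowLine.tendsto_centralTime (hμ : IsRegularData b μ) (hρ : IsCore b μ ρ) (hε : 0 ≤ ε)
    (hz : IsFlowLine μ ρ ε L T z) (hT : 0 < T)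
    (hu : ∀ s ∈ Ioc 0 T, 2 / 3 * mass μ (z s).2.1 < collapseTime μ (z s).2.1 - (z s).1)
    {p₀ B : ℝ} (hp₀ : 0 < p₀) (hp : ∀ s ∈ Ioc 0 T, p₀ ≤ (z s).2.2)
    (hB : (z T).1 - centralTime μ < p₀ * B)
    (hesc : T = B ∨ ∀ K ⊆ outgoingRegion μ ρ, IsCompact K → ∃ s ∈ Ioc 0 T, z s ∉ K) :
    Tendsto (fun s => (z s).1) (𝓝[>] 0) (𝓝 (centralTime μ)) := by
  have hTm : T ∈ Ioc 0 T := ⟨hT, le_rfl⟩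
  have hesc' : ∀ K ⊆ outgoingRegion μ ρ, IsCompact K → ∃ s ∈ Ioc 0 T, z s ∉ K := by
    -- Since `t' = E ≥ p₀`, a lifetime `B` would lower `t` by at least `p₀ B`, which is more than
    -- `t(T) - t₀`.
    refine hesc.resolve_left fun hTB => ?_
    subst hTB
    have hmono := monotoneOn_Ioc_of_hasDerivAt (fun s hs =>
      (hz.hasDerivAt_t hs).sub ((hasDerivAt_id s).const_mul p₀)) fun s hs => by
        have := (hp s hs).trans (le_energy (μ := μ) (L := L) (r := (z s).2.1) (t := (z s).1) hε)
        linarith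
    have key : ∀ s ∈ Ioc 0 T, p₀ * T - p₀ * s ≤ (z T).1 - centralTime μ := fun s hs => by
      have h1 := hmono hs hTm hs.2
      have h2 := (hz s hs).1.2.2.1
      simp only [Pi.sub_apply, id] at h1
      linarith
    have h1 : Tendsto (fun s => p₀ * T - p₀ * s) (𝓝[>] 0) (𝓝 (p₀ * T)) :=
      (Continuous.tendsto' (by fun_prop) _ _ (by simp)).mono_left nhdsWithin_le_nhds
    have h2 := le_of_tendsto h1 (by
      filter_upwards [Ioc_mem_nhdsGT hT] with s hs using key s hs)
    linarith
  have main : ∀ t' > centralTime μ, ∃ s ∈ Ioc 0 T, (z s).1 < t' := by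
    by_contra! hcon
    obtain ⟨t', ht', hge⟩ := hcon
    obtain ⟨σ, hσ, hσr⟩ := exists_collapseTime_lt hμ hρ ht'
    have hrσ : ∀ s ∈ Ioc 0 T, σ ≤ (z s).2.1 := fun s hs =>
      hσr _ (hz s hs).1.1 ((hge s hs).trans_lt (hz s hs).1.2.1)
    have hσm := hμ.mass_pos' (hρ.mem hσ)
    -- While `r ≥ σ`, untrappedness gives `x²/(2R) ≤ 1/(2 m(σ))`. The negative term in the
    -- derivative of `log (E + p) - x` is therefore compensated by `t/(2 m(σ))`, and `p` stays
    -- bounded above.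
    have hmono := monotoneOn_Ioc_of_hasDerivAt (fun s hs =>
      (hz.hasDerivAt_log_energy_add hμ hρ hε hs).add
        ((hz.hasDerivAt_t hs).const_mul (1 / (2 * mass μ σ)))) fun s hs => by
        have hm := (hz s hs).1
        have h1 := areaRadius_pos hμ (hρ.mem hm.1) hm.2.1
        have h2 := energy_pos (μ := μ) (L := L) (r := (z s).2.1) (t := (z s).1) hε hm.2.2.2
        have h3 := trapping_pos hμ (hρ.mem hm.1) hm.2.1
        have h4 := trapping_sq hμ (hρ.mem hm.1) hm.2.1
        have h5 := mass_lt_areaRadius hμ (hρ.mem hm.1) (hu s hs)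
        have h6 := (strictMonoOn_mass hμ hρ).monotoneOn hσ hm.1 (hrσ s hs)
        have h7 := trapping_lt_one hμ (hρ.mem hm.1) (hu s hs)
        have hpp := hm.2.2.2
        have h8 : trapping μ (z s).2.1 (z s).1 ^ 2 / (2 * areaRadius μ (z s).2.1 (z s).1)
            ≤ 1 / (2 * mass μ σ) := by
          refine div_le_div₀ zero_le_one ?_ (by positivity) (by linarith)
          nlinarith
        have h9 := mul_le_mul_of_nonneg_right h8 h2.le
        have h10 : 0 ≤ (1 + trapping μ (z s).2.1 (z s).1)
          * (L ^ 2 / areaRadius μ (z s).2.1 (z s).1 ^ 3)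
          / (energy μ ε L (z s).2.1 (z s).1 (z s).2.2 + (z s).2.2) := by positivity
        linarith
    set Q := Real.log (energy μ ε L (z T).2.1 (z T).1 (z T).2.2 + (z T).2.2)
        - trapping μ (z T).2.1 (z T).1 + 1 / (2 * mass μ σ) * (z T).1 with hQ
    have hpmax : ∀ s ∈ Ioc 0 T, (z s).2.2 ≤ Real.exp (Q + 1) := fun s hs => by
      have hm := (hz s hs).1
      have h := hmono hs hTm hs.2
      simp only [Pi.add_apply] at h
      rw [← hQ] at h
      have h1 := trapping_lt_one hμ (hρ.mem hm.1) (hu s hs)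
      have h2 := energy_pos (μ := μ) (L := L) (r := (z s).2.1) (t := (z s).1) hε hm.2.2.2
      have h3 : 0 < (z s).1 := (centralTime_pos hμ).trans hm.2.2.1
      have h4 : 0 ≤ 1 / (2 * mass μ σ) * (z s).1 := by positivity
      have h5 : Real.log (energy μ ε L (z s).2.1 (z s).1 (z s).2.2 + (z s).2.2) ≤ Q + 1 := by
        linarith
      rw [Real.log_le_iff_le_exp (add_pos h2 hm.2.2.2)] at h5
      linarith
    -- The closed condition `t_c - t ≥ (2/3) m` keeps `K` away from `t = t_c`, which makes it a
    -- compact subset of the open region.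
    let K : Set (ℝ × ℝ × ℝ) := (Icc t' (z T).1 ×ˢ Icc σ (z T).2.1 ×ˢ Icc p₀ (Real.exp (Q + 1)))
      ∩ (fun w => collapseTime μ w.2.1 - w.1 - 2 / 3 * mass μ w.2.1) ⁻¹' Ici 0
    have hin : ∀ w ∈ Icc t' (z T).1 ×ˢ Icc σ (z T).2.1 ×ˢ Icc p₀ (Real.exp (Q + 1)),
        w.2.1 ∈ Ioo 0 ρ := fun w hw =>
      ⟨hσ.1.trans_le hw.2.1.1, hw.2.1.2.trans_lt (hz T hTm).1.1.2⟩
    have hKc : IsCompact K := by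
      have hc : IsCompact (Icc t' (z T).1 ×ˢ Icc σ (z T).2.1 ×ˢ Icc p₀ (Real.exp (Q + 1))) :=
        isCompact_Icc.prod (isCompact_Icc.prod isCompact_Icc)
      refine hc.of_isClosed_subset ?_ inter_subset_left
      refine ContinuousOn.preimage_isClosed_of_isClosed ?_ hc.isClosed isClosed_Ici
      have hc1 := (contDiffOn_collapseTime hμ).continuousOn.comp
        (continuous_fst.comp continuous_snd).continuousOn fun w hw => hρ.mem (hin w hw)
      have hc2 := (contDiffOn_mass hμ).continuousOn.comp
        (continuous_fst.comp continuous_snd).continuousOn fun w hw => hρ.mem (hin w hw)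
      exact (hc1.sub continuousOn_fst).sub (hc2.const_mul (2 / 3))
    have hKU : K ⊆ outgoingRegion μ ρ := by
      rintro w ⟨hw, hw'⟩
      have h1 := hin w hw
      have h2 := hμ.mass_pos' (hρ.mem h1)
      have h3 : 0 ≤ collapseTime μ w.2.1 - w.1 - 2 / 3 * mass μ w.2.1 := hw'
      exact ⟨h1, by linarith, lt_of_lt_of_le ht' hw.1.1, hp₀.trans_le hw.2.2.1⟩
    obtain ⟨s, hs, hsK⟩ := hesc' K hKU hKc
    refine hsK ⟨⟨⟨hge s hs, hz.monotoneOn_t hs hTm hs.2⟩,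
      ⟨hrσ s hs, hz.monotoneOn_r hμ hρ hs hTm hs.2⟩, ⟨hp s hs, hpmax s hs⟩⟩, ?_⟩
    have := hu s hs
    change (0 : ℝ) ≤ _
    linarith
  refine tendsto_order.2 ⟨fun a ha => ?_, fun a ha => ?_⟩
  · filter_upwards [Ioc_mem_nhdsGT hT] with s hs using ha.trans (hz s hs).1.2.2.1
  · obtain ⟨s₀, hs₀, hlt⟩ := main a ha
    filter_upwards [Ioc_mem_nhdsGT hs₀.1] with s hs
    exact (hz.monotoneOn_t ⟨hs.1, hs.2.trans hs₀.2⟩ hs₀ hs.2).trans_lt hlt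

end Untrapped

section NullGeodesics

/-! ### Causal geodesics yield radial null geodesics -/

/-- A curve `(u, v)` with `u' > 0` is the graph of a function over its first coordinate. -/
lemma exists_graph {u v u' v' : ℝ → ℝ} {δ a : ℝ} (hu : ∀ s ∈ Ioo 0 δ, HasDerivAt u (u' s) s)
    (hv : ∀ s ∈ Ioo 0 δ, HasDerivAt v (v' s) s) (hpos : ∀ s ∈ Ioo 0 δ, 0 < u' s)
    (ha : Tendsto u (𝓝[>] 0) (𝓝 a)) :
    ∃ w : ℝ → ℝ, (∀ s ∈ Ioo 0 δ, a < u s ∧ w (u s) = v s ∧ HasDerivAt w (v' s / u' s) (u s)) ∧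
      ∀ s₁ ∈ Ioo 0 δ, ∀ y ∈ Ioc a (u s₁), ∃ s ∈ Ioc 0 s₁, u s = y := by
  have hc : ContinuousOn u (Ioo 0 δ) := HasDerivAt.continuousOn hu
  have hmono : StrictMonoOn u (Ioo 0 δ) := by
    refine strictMonoOn_of_deriv_pos (convex_Ioo 0 δ) hc fun s hs => ?_
    rw [interior_Ioo] at hs
    rw [(hu s hs).deriv]
    exact hpos s hs
  have hlt : ∀ s ∈ Ioo 0 δ, a < u s := by
    intro s hs
    have hs2 : s / 2 ∈ Ioo 0 δ := ⟨by linarith [hs.1], by linarith [hs.1, hs.2]⟩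
    refine lt_of_le_of_lt ?_ (hmono hs2 hs (by linarith [hs.1]))
    refine le_of_tendsto ha ?_
    filter_upwards [Ioo_mem_nhdsGT hs2.1] with x hx
    exact (hmono ⟨hx.1, hx.2.trans hs2.2⟩ hs2 hx.2).le
  have hinv := hmono.injOn.leftInvOn_invFunOn
  set g := Function.invFunOn u (Ioo 0 δ) with hg
  refine ⟨v ∘ g, fun s hs => ⟨hlt s hs, by simp [hinv hs], ?_⟩, ?_⟩
  · have himg : u '' Ioo 0 δ ∈ 𝓝 (u s) := by
      obtain ⟨x, hx0, hxs⟩ := exists_between hs.1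
      obtain ⟨y, hsy, hyδ⟩ := exists_between hs.2
      have hx : x ∈ Ioo 0 δ := ⟨hx0, hxs.trans hs.2⟩
      have hy : y ∈ Ioo 0 δ := ⟨hs.1.trans hsy, hyδ⟩
      have hsub : Icc x y ⊆ Ioo 0 δ := fun w hw => ⟨hx0.trans_le hw.1, hw.2.trans_lt hyδ⟩
      refine mem_of_superset (Icc_mem_nhds (hmono hx hs hxs) (hmono hs hy hsy)) ?_
      exact (intermediate_value_Icc (hxs.trans hsy).le (hc.mono hsub)).trans (image_mono hsub)
    have hgmono : StrictMonoOn g (u '' Ioo 0 δ) := by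
      rintro _ ⟨x, hx, rfl⟩ _ ⟨y, hy, rfl⟩ h
      rw [hinv hx, hinv hy]
      exact (hmono.lt_iff_lt hx hy).1 h
    have hgimg : g '' (u '' Ioo 0 δ) = Ioo 0 δ := by
      rw [← image_comp]
      exact (image_congr hinv).trans (image_id _)
    have hgc : ContinuousAt g (u s) := by
      refine hgmono.continuousAt_of_image_mem_nhds himg ?_
      rw [hgimg, hinv hs]
      exact isOpen_Ioo.mem_nhds hs
    have hgd : HasDerivAt g (u' s)⁻¹ (u s) := by
      refine HasDerivAt.of_local_left_inverse (f := u) hgc ?_ (hpos s hs).ne' ?_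
      · rw [hinv hs]; exact hu s hs
      · filter_upwards [himg] with y hy
        obtain ⟨x, hx, rfl⟩ := hy
        rw [hinv hx]
    have hvs : HasDerivAt v (v' s) (g (u s)) := by rw [hinv hs]; exact hv s hs
    exact (hvs.comp (u s) hgd).congr_deriv (by rw [div_eq_mul_inv])
  · intro s₁ hs₁ y hy
    obtain ⟨x, hx, hxs⟩ := ((ha.eventually (gt_mem_nhds hy.1)).and (Ioo_mem_nhdsGT hs₁.1)).exists
    have hsub : Icc x s₁ ⊆ Ioo 0 δ := fun w hw => ⟨hxs.1.trans_le hw.1, hw.2.trans_lt hs₁.2⟩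
    obtain ⟨s, hs, h⟩ := intermediate_value_Icc hxs.2.le (hc.mono hsub) ⟨le_of_lt hx, hy.2⟩
    exact ⟨s, ⟨hxs.1.trans_le hs.1, hs.2⟩, h⟩

variable {b : ℝ} {μ : ℝ → ℝ} {ρ : ℝ} {ε L δ : ℝ} {t r : ℝ → ℝ}

lemma IsGeodesic.hasDerivAt_t (hg : IsGeodesic b μ ε L δ t r) {s : ℝ} (hs : s ∈ Ioo 0 δ) :
    HasDerivAt t (deriv t s) s :=
  ((hg.contDiffOn_t.contDiffAt (isOpen_Ioo.mem_nhds hs)).differentiableAt two_ne_zero).hasDerivAt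

lemma IsGeodesic.hasDerivAt_r (hg : IsGeodesic b μ ε L δ t r) {s : ℝ} (hs : s ∈ Ioo 0 δ) :
    HasDerivAt r (deriv r s) s :=
  ((hg.contDiffOn_r.contDiffAt (isOpen_Ioo.mem_nhds hs)).differentiableAt two_ne_zero).hasDerivAt

lemma IsGeodesic.radial_le (hg : IsGeodesic b μ ε L δ t r) (hε : 0 ≤ ε) {s : ℝ} (hs : s ∈ Ioo 0 δ)
    (ht : 0 ≤ deriv t s) : areaRadius_r μ (r s) (t s) * deriv r s ≤ deriv t s := by
  have h := hg.eq_norm s hs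
  have : 0 ≤ L ^ 2 / areaRadius μ (r s) (t s) ^ 2 := by positivity
  exact (abs_le_of_sq_le_sq' (by linarith) ht).2

lemma areaRadius_le (hμ : IsRegularData b μ) {r t : ℝ} (hr : r ∈ Ioo 0 b) (ht0 : 0 ≤ t)
    (ht : t < collapseTime μ r) : areaRadius μ r t ≤ r := by
  have hm := hμ.mass_pos' hr
  have h1 := areaRadius_cube hμ hr ht
  have h2 := collapseTime_sq hμ hr
  have h3 : (collapseTime μ r - t) ^ 2 ≤ collapseTime μ r ^ 2 :=
    pow_le_pow_left₀ (by linarith) (by linarith) 2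
  have h4 : areaRadius μ r t ^ 3 ≤ r ^ 3 := by
    rw [h1, ← h2]
    exact mul_le_mul_of_nonneg_left h3 (by positivity)
  exact le_of_pow_le_pow_left₀ (by norm_num) hr.1.le h4

lemma one_le_trapping (hμ : IsRegularData b μ) {r t : ℝ} (hr : r ∈ Ioo 0 b)
    (ht : t < collapseTime μ r) (h : collapseTime μ r - t ≤ 2 / 3 * mass μ r) :
    1 ≤ trapping μ r t := by
  have h1 := trapping_pos hμ hr ht
  have h2 := trapping_sq hμ hr ht
  have h3 := areaRadius_pos hμ hr ht
  rw [collapseTime_sub_eq hμ hr ht, div_le_iff₀ h1, ← h2] at h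
  have h4 : 1 ≤ trapping μ r t ^ 3 := by
    by_contra! h5
    nlinarith
  by_contra! h5
  exact absurd (pow_lt_one₀ h1.le h5 (by norm_num : 3 ≠ 0)) (not_lt.2 h4)

/-- A causal geodesic that emanates from the singularity contains untrapped points arbitrarily
close to it. -/
lemma IsGeodesic.exists_untrapped (hμ : IsRegularData b μ) (hg : IsGeodesic b μ ε L δ t r)
    (hε : 0 ≤ ε) (ht : ∀ s ∈ Ioo 0 δ, 0 ≤ deriv t s) (hr : Tendsto r (𝓝[>] 0) (𝓝 0))
    {δ' : ℝ} (hδ' : 0 < δ') (hle : δ' ≤ δ) :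
    ∃ s ∈ Ioo 0 δ', 2 / 3 * mass μ (r s) < collapseTime μ (r s) - t s := by
  -- If all points near the singularity had `x ≥ 1`, then `R' = R_{,r} r' - x t' ≤ (1 - x) t' ≤ 0`.
  -- So `R` could not grow from its limit `0`.
  by_contra! hcon
  have hsub : Ioo 0 δ' ⊆ Ioo 0 δ := Ioo_subset_Ioo_right hle
  have hd : ∀ s ∈ Ioo 0 δ', HasDerivAt (fun u => areaRadius μ (r u) (t u)) _ s := fun s hs =>
    hasDerivAt_areaRadius_comp hμ (hg.r_mem s (hsub hs)) (hg.t_mem s (hsub hs)).2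
      (hg.hasDerivAt_r (hsub hs)) (hg.hasDerivAt_t (hsub hs))
  have hanti : AntitoneOn (fun u => areaRadius μ (r u) (t u)) (Ioo 0 δ') := by
    refine antitoneOn_of_deriv_nonpos (convex_Ioo 0 δ') (HasDerivAt.continuousOn hd) ?_ ?_
    · rw [interior_Ioo]
      exact fun s hs => (hd s hs).differentiableAt.differentiableWithinAt
    · rw [interior_Ioo]
      intro s hs
      have hrs := hg.r_mem s (hsub hs)
      have hts := (hg.t_mem s (hsub hs)).2
      rw [(hd s hs).deriv, ← areaRadius_r_eq hμ hrs hts]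
      have h1 := hg.radial_le hε (hsub hs) (ht s (hsub hs))
      have h2 := one_le_trapping hμ hrs hts (hcon s hs)
      nlinarith [ht s (hsub hs)]
  have hmid : δ' / 2 ∈ Ioo 0 δ' := ⟨by linarith, by linarith⟩
  have h0 := areaRadius_pos hμ (hg.r_mem _ (hsub hmid)) (hg.t_mem _ (hsub hmid)).2
  refine absurd (ge_of_tendsto hr (b := areaRadius μ (r (δ' / 2)) (t (δ' / 2))) ?_) (not_le.2 h0)
  filter_upwards [Ioo_mem_nhdsGT hmid.1] with s hs
  have hs' : s ∈ Ioo 0 δ' := ⟨hs.1, hs.2.trans hmid.2⟩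
  have h1 := areaRadius_le hμ (hg.r_mem _ (hsub hs')) (hg.t_mem _ (hsub hs')).1
    (hg.t_mem _ (hsub hs')).2
  exact (hanti hs' hmid hs.2.le).trans h1

/-- If a causal geodesic that is not radial null emanates from the singularity, so does a radial
null geodesic. -/
lemma radialNullEmanates_of_emanates (hμ : IsRegularData b μ) (hε : 0 ≤ ε)
    (hεL : 0 < ε + L ^ 2) (hem : Emanates b μ ε L) : RadialNullEmanates b μ := by
  obtain ⟨δ, t, r, hδ, hg, ht, -, -, hr0, ht0⟩ := hem
  obtain ⟨ρ, hρ⟩ := exists_isCore hμ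
  obtain ⟨δ₁, hδ₁, hsub⟩ := mem_nhdsGT_iff_exists_Ioo_subset.1 (inter_mem
    (hr0.eventually (gt_mem_nhds hρ.pos)) (Ioo_mem_nhdsGT hδ))
  have hδ₁' : 0 < δ₁ := hδ₁
  have hle : δ₁ ≤ δ := by
    by_contra! h
    exact absurd (hsub ⟨hδ, h⟩).2.2 (lt_irrefl _)
  have hmemδ : ∀ s ∈ Ioo 0 δ₁, s ∈ Ioo 0 δ := fun s hs => (hsub hs).2
  have hrm : ∀ s ∈ Ioo 0 δ₁, r s ∈ Ioo 0 ρ := fun s hs =>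
    ⟨(hg.r_mem s (hmemδ s hs)).1, (hsub hs).1⟩
  have hstrict : ∀ s ∈ Ioo 0 δ₁, 0 < deriv t s ∧
      areaRadius_r μ (r s) (t s) * deriv r s < deriv t s := by
    intro s hs
    have h := hg.eq_norm s (hmemδ s hs)
    have hR := areaRadius_pos hμ (hg.r_mem s (hmemδ s hs)) (hg.t_mem s (hmemδ s hs)).2
    have hpos : 0 < ε + L ^ 2 / areaRadius μ (r s) (t s) ^ 2 := by
      rcases eq_or_lt_of_le hε with h0 | h0
      · rw [← h0, zero_add] at hεL ⊢
        positivity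
      · positivity
    have ht' := ht s (hmemδ s hs)
    have hlt : (areaRadius_r μ (r s) (t s) * deriv r s) ^ 2 < deriv t s ^ 2 := by linarith
    refine ⟨lt_of_le_of_ne ht' fun h0 => ?_, (abs_lt_of_sq_lt_sq' hlt ht').2⟩
    rw [← h0] at hlt
    nlinarith [sq_nonneg (areaRadius_r μ (r s) (t s) * deriv r s)]
  obtain ⟨w, hw, hwsurj⟩ := exists_graph (fun s hs => hg.hasDerivAt_t (hmemδ s hs))
    (fun s hs => hg.hasDerivAt_r (hmemδ s hs)) (fun s hs => (hstrict s hs).1) ht0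
  obtain ⟨s₁, hs₁, hs₁u⟩ := hg.exists_untrapped hμ hε ht hr0 hδ₁' hle
  -- Being untrapped is an open condition, so the null ray can start at the same time, strictly
  -- inside the given geodesic.
  obtain ⟨r₁, hr₁u, hr₁⟩ : ∃ r₁, 2 / 3 * mass μ r₁ < collapseTime μ r₁ - t s₁ ∧
      r₁ ∈ Ioo 0 (r s₁) := by
    have hrb := hρ.mem (hrm s₁ hs₁)
    have hc : ∀ᶠ x in 𝓝 (r s₁), 2 / 3 * mass μ x < collapseTime μ x - t s₁ :=
      ((hasDerivAt_mass hμ hrb).continuousAt.const_mul (2 / 3)).eventually_lt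
        ((hasDerivAt_collapseTime hμ hrb).continuousAt.sub_const _) hs₁u
    exact ((hc.filter_mono nhdsWithin_le_nhds).and (Ioo_mem_nhdsLT hrb.1)).exists
  have hr₁ρ : r₁ ∈ Ioo 0 ρ := ⟨hr₁.1, hr₁.2.trans (hrm s₁ hs₁).2⟩
  have hm₁ := hμ.mass_pos' (hρ.mem hr₁ρ)
  have hstart : (t s₁, r₁, (1 : ℝ)) ∈ outgoingRegion μ ρ :=
    ⟨hr₁ρ, by simp only; linarith, (hw s₁ hs₁).1, one_pos⟩
  set p₀ := Real.exp (-1) with hp₀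
  have hp₀' : 0 < p₀ := Real.exp_pos _
  have ht1 : 0 < t s₁ - centralTime μ := sub_pos.2 (hw s₁ hs₁).1
  obtain ⟨T, hTB, z, hzT, hz, hesc⟩ := exists_flowLine hμ hρ (ε := 0) (L := 0) le_rfl hstart
    (B := (t s₁ - centralTime μ) / p₀ + 1) (by positivity)
  have hT := hTB.1
  have hu := hz.untrapped hμ hρ le_rfl (by rw [hzT]; exact hr₁u)
  have hp : ∀ s ∈ Ioc 0 T, p₀ ≤ (z s).2.2 := fun s hs => by
    have := hz.momentum_bound_of_null hμ hρ hT hu s hs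
    rwa [hzT, one_mul] at this
  have hztend := hz.tendsto_centralTime hμ hρ le_rfl hT hu hp₀' hp
    (B := (t s₁ - centralTime μ) / p₀ + 1) (by rw [hzT]; field_simp; linarith) hesc
  have hσ : ∀ s ∈ Ioc 0 T, ∃ σ ∈ Ioc 0 s₁, t σ = (z s).1 := fun s hs =>
    hwsurj s₁ hs₁ _ ⟨(hz s hs).1.2.2.1, by
      have := hz.monotoneOn_t hs ⟨hT, le_rfl⟩ hs.2
      simpa [hzT] using this⟩
  choose! σ hσ1 hσ2 using hσ
  have hσm : ∀ s ∈ Ioc 0 T, σ s ∈ Ioo 0 δ₁ := fun s hs =>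
    ⟨(hσ1 s hs).1, (hσ1 s hs).2.trans_lt hs₁.2⟩
  have hwd : ∀ s ∈ Ioc 0 T, w (z s).1 = r (σ s) ∧
      HasDerivAt w (deriv r (σ s) / deriv t (σ s)) (z s).1 := fun s hs => by
    have := (hw _ (hσm s hs)).2
    rwa [hσ2 s hs] at this
  -- At a meeting point the geodesic has `dr/dt < 1/R_{,r}`, the value for the ray. The difference
  -- of radii would be decreasing there, although it is positive afterwards.
  have hcmp : ∀ s ∈ Ioc 0 T, 0 < w (z s).1 - (z s).2.1 := by
    refine pos_of_deriv_neg_at_zeros (T := T) (h := fun s => w (z s).1 - (z s).2.1)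
      (h' := fun s => deriv r (σ s) / deriv t (σ s) * energy μ 0 0 (z s).2.1 (z s).1 (z s).2.2
        - (z s).2.2 / (areaRadius μ (z s).2.1 (z s).1 * radialLogRate μ (z s).2.1 (z s).1))
      (fun s hs => ?_) ?_ ?_
    · have h : HasDerivAt (w ∘ fun u => (z u).1) _ s := (hwd s hs).2.comp s (hz.hasDerivAt_t hs)
      exact h.sub (hz.hasDerivAt_r hs)
    · rw [hzT, (hw s₁ hs₁).2.1]
      linarith [hr₁.2]
    · intro s hs h0 _
      have hs' := Ioo_subset_Ioc_self hs
      have hm := (hz s hs').1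
      have hp' := hm.2.2.2
      have hE : energy μ 0 0 (z s).2.1 (z s).1 (z s).2.2 = (z s).2.2 := by
        simp [energy, Real.sqrt_sq hp'.le]
      have heq : r (σ s) = (z s).2.1 := by rw [← (hwd s hs').1]; linarith
      have hst := hstrict _ (hσm s hs')
      have hRr := mul_pos (areaRadius_pos hμ (hρ.mem hm.1) hm.2.1)
        (radialLogRate_pos hμ hρ hm.1 hm.2.1)
      rw [heq, hσ2 s hs', areaRadius_r_eq hμ (hρ.mem hm.1) hm.2.1] at hst
      rw [hE, sub_neg, div_mul_eq_mul_div, div_lt_div_iff₀ hst.1 hRr]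
      nlinarith [hst.2]
  refine hz.emanates hμ hρ le_rfl hT hztend ?_
  refine tendsto_order.2 ⟨fun a ha => ?_, fun a ha => ?_⟩
  · filter_upwards [Ioc_mem_nhdsGT hT] with s hs using ha.trans (hz s hs).1.1.1
  -- The ray is inside the geodesic at equal times, and the geodesic has `r → 0` as `t → t₀`.
  · obtain ⟨s₂, hs₂, hlt⟩ := mem_nhdsGT_iff_exists_Ioo_subset.1 (inter_mem
      (hr0.eventually (gt_mem_nhds ha)) (Ioo_mem_nhdsGT hδ₁'))
    have hs₂' : 0 < s₂ := hs₂
    have hmid : s₂ / 2 ∈ Ioo 0 s₂ := ⟨by linarith, by linarith⟩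
    have hmid' : s₂ / 2 ∈ Ioo 0 δ₁ := (hlt hmid).2
    filter_upwards [hztend.eventually (gt_mem_nhds (hw _ hmid').1), Ioc_mem_nhdsGT hT]
      with s hs hsT
    obtain ⟨s', hs', hts'⟩ := hwsurj _ hmid' (z s).1 ⟨(hz s hsT).1.2.2.1, hs.le⟩
    have hs'2 : s' ∈ Ioo 0 s₂ := ⟨hs'.1, hs'.2.trans_lt hmid.2⟩
    have h1 := (hw s' (hlt hs'2).2).2.1
    have h2 : r s' < a := (hlt hs'2).1
    have h3 := hcmp s hsT
    rw [← hts', h1] at h3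
    linarith

end NullGeodesics

section Barriers

/-! ### Barriers and timelike geodesics -/

/-- Write `u = v³ - 1`. The first estimate is the second-order Taylor bound for `(1 + u)^(2/3)`, the
second a weakened one for `(1 + u)^(-1/3)`. The concave loss `-a u²/9` is absorbed by the convex
gain thanks to `3 a v³ ≤ 2 τ`, and the constant `36` is what remains when this hypothesis is used to
the full. -/
lemma radial_convexity_aux {a τ v : ℝ} (ha : 0 < a) (hτ : 0 < τ) (hv : 1 ≤ v)
    (h : 3 * (a * v ^ 3) ≤ 2 * τ) :
    a + 2 / 3 * τ + 2 / 3 * a * (v ^ 3 - 1) - 2 / 9 * τ * (v ^ 3 - 1)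
      + (a + 2 / 3 * τ) * (v ^ 3 - 1) ^ 2 / (36 * v ^ 3) ≤ a * v ^ 2 + 2 / 3 * τ / v := by
  have hv0 : 0 < v := by linarith
  have hv3 : 1 ≤ v ^ 3 := one_le_pow₀ hv
  have h1 : 1 + 2 / 3 * (v ^ 3 - 1) - (v ^ 3 - 1) ^ 2 / 9 ≤ v ^ 2 := by
    have : v ^ 2 - (1 + 2 / 3 * (v ^ 3 - 1) - (v ^ 3 - 1) ^ 2 / 9)
        = (v - 1) ^ 3 * (v ^ 3 + 3 * v ^ 2 + 6 * v + 2) / 9 := by ring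
    have h' : 0 ≤ (v - 1) ^ 3 * (v ^ 3 + 3 * v ^ 2 + 6 * v + 2) / 9 := by
      have : 0 ≤ v - 1 := by linarith
      positivity
    linarith
  have h2 : 1 - (v ^ 3 - 1) / 3 + (v ^ 3 - 1) ^ 2 / (6 * v ^ 3) ≤ 1 / v := by
    have e : 1 / v - (1 - (v ^ 3 - 1) / 3 + (v ^ 3 - 1) ^ 2 / (6 * v ^ 3))
        = (v - 1) ^ 2 * ((v ^ 4 - v) + (v ^ 3 - v) + (v ^ 3 - 1) + 3 * v ^ 2) / (6 * v ^ 3) := by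
      field_simp
      ring
    have h3 : 0 ≤ v ^ 4 - v := by nlinarith
    have h4 : 0 ≤ v ^ 3 - v := by nlinarith
    have h5 : 0 ≤ v ^ 3 - 1 := by linarith
    have h' : 0 ≤ (v - 1) ^ 2 * ((v ^ 4 - v) + (v ^ 3 - v) + (v ^ 3 - 1) + 3 * v ^ 2)
      / (6 * v ^ 3) := by positivity
    linarith
  have h3 : (a + 2 / 3 * τ) * (v ^ 3 - 1) ^ 2 / (36 * v ^ 3)
      ≤ -a * (v ^ 3 - 1) ^ 2 / 9 + 2 / 3 * τ * ((v ^ 3 - 1) ^ 2 / (6 * v ^ 3)) := by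
    have e : -a * (v ^ 3 - 1) ^ 2 / 9 + 2 / 3 * τ * ((v ^ 3 - 1) ^ 2 / (6 * v ^ 3))
        - (a + 2 / 3 * τ) * (v ^ 3 - 1) ^ 2 / (36 * v ^ 3)
        = (v ^ 3 - 1) ^ 2 * ((4 * τ - 4 * (a * v ^ 3)) - (a + 2 / 3 * τ)) / (36 * v ^ 3) := by
      field_simp
      ring
    have h4 : a ≤ a * v ^ 3 := le_mul_of_one_le_right ha.le hv3
    have h5 : 0 ≤ (4 * τ - 4 * (a * v ^ 3)) - (a + 2 / 3 * τ) := by linarith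
    have h' : 0 ≤ (v ^ 3 - 1) ^ 2 * ((4 * τ - 4 * (a * v ^ 3)) - (a + 2 / 3 * τ))
      / (36 * v ^ 3) := by positivity
    linarith
  have h4 := mul_le_mul_of_nonneg_left h1 ha.le
  have h5 := mul_le_mul_of_nonneg_left h2 (by positivity : 0 ≤ 2 / 3 * τ)
  have h6 : 2 / 3 * τ / v = 2 / 3 * τ * (1 / v) := by ring
  rw [h6]
  linarith

variable {b : ℝ} {μ : ℝ → ℝ} {ρ : ℝ}

/-- Quantitative convexity of `R_{,r}(r, ·)`: an upper bound at times `t` after `n`, provided that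
`t_c - n` is controlled by `t_c'`. -/
lemma radial_convexity (hμ : IsRegularData b μ) (hρ : IsCore b μ ρ) {r n t : ℝ}
    (hr : r ∈ Ioo 0 ρ) (hnt : n < t) (ht : t < collapseTime μ r)
    (h : 3 * massRate μ r * (collapseTime μ r - n) ≤ 2 * collapseRate μ r) :
    areaRadius μ r t * radialLogRate μ r t * (1 - hubble μ r t * (t - n)
        + (t - n) ^ 2 / (36 * ((collapseTime μ r - t) * (collapseTime μ r - n))))
      ≤ areaRadius μ r n * radialLogRate μ r n := by
  have hrb := hρ.mem hr
  have hg := massRate_pos hμ hρ hr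
  have hτ := collapseRate_pos hμ hrb
  have hq := radialLogRate_pos hμ hρ hr ht
  have hR := areaRadius_pos hμ hrb ht
  have hRn := areaRadius_pos hμ hrb (hnt.trans ht)
  have hc := areaRadius_cube hμ hrb ht
  have hcn := areaRadius_cube hμ hrb (hnt.trans ht)
  have hy : 0 < collapseTime μ r - t := by linarith
  have hz : 0 < collapseTime μ r - n := by linarith
  have hyz : collapseTime μ r - t < collapseTime μ r - n := by linarith
  have hd : t - n = (collapseTime μ r - n) - (collapseTime μ r - t) := by ring
  rw [hd]
  have hHq : hubble μ r t * radialLogRate μ r t = mixedLogRate μ r t := by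
    unfold hubble; field_simp
  have key : radialLogRate μ r t * (1 - hubble μ r t
        * ((collapseTime μ r - n) - (collapseTime μ r - t))
        + ((collapseTime μ r - n) - (collapseTime μ r - t)) ^ 2
          / (36 * ((collapseTime μ r - t) * (collapseTime μ r - n))))
      = radialLogRate μ r t - mixedLogRate μ r t
        * ((collapseTime μ r - n) - (collapseTime μ r - t)) + radialLogRate μ r t *
        ((collapseTime μ r - n) - (collapseTime μ r - t)) ^ 2
          / (36 * ((collapseTime μ r - t) * (collapseTime μ r - n))) := by
    rw [← hHq]; ring
  rw [mul_assoc, key]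
  unfold radialLogRate mixedLogRate
  generalize massRate μ r = g at *
  generalize collapseRate μ r = τ at *
  generalize areaRadius μ r t = R at *
  generalize areaRadius μ r n = Rn at *
  generalize collapseTime μ r - t = y at *
  generalize collapseTime μ r - n = z at *
  -- With `v³ = (t_c - n)/(t_c - t)`, the area radius scales by `v²`. Thus `R_{,r}` splits into a
  -- concave part in `v²` and a convex part in `1/v`.
  obtain ⟨v, hv0, hv⟩ : ∃ v : ℝ, 0 < v ∧ v ^ 3 = z / y := by
    refine ⟨(z / y) ^ ((1 : ℝ) / 3), by positivity, ?_⟩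
    rw [← Real.rpow_natCast, ← Real.rpow_mul (by positivity)]
    norm_num
  have hzv : z = y * v ^ 3 := by rw [hv]; field_simp
  subst hzv
  have hv1 : 1 ≤ v := by
    by_contra! hlt
    have : v ^ 3 < 1 := pow_lt_one₀ hv0.le hlt (by norm_num)
    nlinarith
  have hRnv : Rn = R * v ^ 2 := by
    refine (pow_left_inj₀ hRn.le (by positivity) (by norm_num : 3 ≠ 0)).1 ?_
    rw [hcn]
    linear_combination -(v ^ 6) * hc
  rw [hRnv, mul_assoc]
  refine mul_le_mul_of_nonneg_left ?_ hR.le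
  have haux := radial_convexity_aux (a := g * y) (by positivity) hτ hv1 (by linarith)
  have e1 : v ^ 2 * (g + 2 / 3 * τ / (y * v ^ 3)) = (g * y * v ^ 2 + 2 / 3 * τ / v) / y := by
    field_simp
  rw [e1, le_div_iff₀ hy]
  refine le_trans (le_of_eq ?_) haux
  field_simp
  ring

/-- A causal curve `t = N(r)` emanating from the singularity, staying within a bounded multiple of
the mass below the collapse time, and partly outside of the trapped region. -/
structure IsBarrier (μ : ℝ → ℝ) (ρ C : ℝ) (N N' : ℝ → ℝ) : Prop where
  hasDerivAt : ∀ r ∈ Ioo 0 ρ, HasDerivAt N (N' r) r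
  central_lt : ∀ r ∈ Ioo 0 ρ, centralTime μ < N r
  gap_le : ∀ r ∈ Ioo 0 ρ, collapseTime μ r - N r ≤ C * mass μ r
  rate_le : ∀ r ∈ Ioo 0 ρ, 3 * massRate μ r * (collapseTime μ r - N r) ≤ 2 * collapseRate μ r
  causal : ∀ r ∈ Ioo 0 ρ, areaRadius μ r (N r) * radialLogRate μ r (N r) ≤ N' r
  untrapped : ∃ r ∈ Ioo 0 ρ, 2 / 3 * mass μ r < collapseTime μ r - N r

/-- From `(E + p) D ≥ Z` and `D ≤ C m` one gets `E + p ≥ Z/(C m)`, which dominates the angular term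
`L/R < L/m`. Hence `(E + p)(E - p) = ε + L²/R²` is at most half of `(E + p)²`, that is, `E ≤ 3p`. -/
lemma momentum_lower_bounds {E p R m C D ε L Z : ℝ} (hm : 0 < m) (hm1 : m ≤ 1) (hmR : m < R)
    (hD : 0 < D) (hDC : D ≤ C * m) (hE : 0 < E) (hp : 0 < p) (hε1 : ε ≤ 1)
    (hsq : E ^ 2 = p ^ 2 + ε + L ^ 2 / R ^ 2) (hZ : 0 < Z) (hZ1 : 2 * C ^ 2 * (1 + L ^ 2) ≤ Z ^ 2)
    (hZle : Z ≤ (E + p) * D) : E + p ≤ 4 * p ∧ Z / (4 * C) ≤ p := by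
  have hC : 0 < C := by
    by_contra! h
    nlinarith
  have h1 : Z ≤ (E + p) * (C * m) := hZle.trans (mul_le_mul_of_nonneg_left hDC (by positivity))
  have h2 : Z ^ 2 ≤ ((E + p) * (C * m)) ^ 2 := pow_le_pow_left₀ hZ.le h1 2
  have h3 : L ^ 2 / R ^ 2 ≤ L ^ 2 / m ^ 2 :=
    div_le_div_of_nonneg_left (by positivity) (by positivity) (pow_le_pow_left₀ hm.le hmR.le 2)
  have h4 : 2 * (1 + L ^ 2) ≤ (E + p) ^ 2 * m ^ 2 := by
    have : C ^ 2 * (2 * (1 + L ^ 2)) ≤ C ^ 2 * ((E + p) ^ 2 * m ^ 2) := by nlinarith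
    exact le_of_mul_le_mul_left this (by positivity)
  have h5 : 2 * (ε + L ^ 2 / m ^ 2) ≤ (E + p) ^ 2 := by
    have hm2 : m ^ 2 ≤ 1 := pow_le_one₀ hm.le hm1
    have : 2 * (1 + L ^ 2) / m ^ 2 ≤ (E + p) ^ 2 := by
      rwa [div_le_iff₀ (by positivity)]
    refine le_trans ?_ this
    rw [le_div_iff₀ (by positivity)]
    have : 2 * (ε + L ^ 2 / m ^ 2) * m ^ 2 = 2 * (ε * m ^ 2 + L ^ 2) := by field_simp
    rw [this]
    nlinarith [pow_pos hm 2]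
  have h6 : E + p ≤ 4 * p := by
    have : (E + p) * (E - p) = ε + L ^ 2 / R ^ 2 := by linear_combination hsq
    have : (E + p) * (2 * (E - p)) ≤ (E + p) * (E + p) := by nlinarith
    have := le_of_mul_le_mul_left this (by positivity)
    linarith
  refine ⟨h6, ?_⟩
  rw [div_le_iff₀ (by positivity)]
  have : (E + p) * (C * m) ≤ (E + p) * C := by
    refine mul_le_mul_of_nonneg_left ?_ (by positivity)
    nlinarith
  nlinarith

/-- The two angular terms are at most `2C L²/m²` and `L²/m²`. The convexity term is at least their
sum, because `y n ≤ C² m²` and `(E + p) p D² ≥ Z²/4`; hence the threshold `144 = 4 · 36`. Only `ε`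
survives. -/
lemma drift_le {E p R m C D ε L Z x y n : ℝ} (hm : 0 < m) (hmR : m < R)
    (hx : x < 1) (hD : 0 < D) (hDC : D ≤ C * m) (hy : 0 < y) (hyC : y ≤ C * m)
    (hn : 0 < n) (hnC : n ≤ C * m) (hE : 0 < E) (hp : 0 < p)
    (hsq : E ^ 2 = p ^ 2 + ε + L ^ 2 / R ^ 2) (hZ : 0 < Z)
    (hZ2 : 144 * C ^ 2 * (L ^ 2 * (1 + 2 * C)) ≤ Z ^ 2) (hZle : Z ≤ (E + p) * D)
    (hEp : E + p ≤ 4 * p) :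
    (1 + x) * (L ^ 2 / R ^ 3) * D + (E + p) * (E - p) - (E + p) * p * D ^ 2 / (36 * (y * n))
      ≤ ε := by
  have hC : 0 < C := by
    by_contra! h
    nlinarith
  have hR : 0 < R := hm.trans hmR
  have h1 : (E + p) * (E - p) = ε + L ^ 2 / R ^ 2 := by linear_combination hsq
  have h2 : L ^ 2 / R ^ 2 ≤ L ^ 2 / m ^ 2 :=
    div_le_div_of_nonneg_left (by positivity) (by positivity) (pow_le_pow_left₀ hm.le hmR.le 2)
  have h3 : L ^ 2 / R ^ 3 ≤ L ^ 2 / m ^ 3 :=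
    div_le_div_of_nonneg_left (by positivity) (by positivity) (pow_le_pow_left₀ hm.le hmR.le 3)
  have h4 : (1 + x) * (L ^ 2 / R ^ 3) * D ≤ 2 * C * (L ^ 2 / m ^ 2) := by
    have : 2 * C * (L ^ 2 / m ^ 2) = 2 * (L ^ 2 / m ^ 3) * (C * m) := by field_simp
    rw [this]
    have h5 : 0 ≤ L ^ 2 / m ^ 3 := by positivity
    have h6 : 0 ≤ L ^ 2 / R ^ 3 := by positivity
    refine mul_le_mul ?_ hDC hD.le (by positivity)
    exact mul_le_mul (by linarith) h3 h6 (by norm_num)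
  have h5 : (1 + 2 * C) * (L ^ 2 / m ^ 2) ≤ (E + p) * p * D ^ 2 / (36 * (y * n)) := by
    have h6 : y * n ≤ (C * m) * (C * m) := mul_le_mul hyC hnC hn.le (by positivity)
    have h7 : Z ^ 2 ≤ 4 * ((E + p) * p * D ^ 2) := by
      calc Z ^ 2 ≤ ((E + p) * D) ^ 2 := pow_le_pow_left₀ hZ.le hZle 2
        _ = (E + p) * D ^ 2 * (E + p) := by ring
        _ ≤ (E + p) * D ^ 2 * (4 * p) := mul_le_mul_of_nonneg_left hEp (by positivity)
        _ = _ := by ring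
    rw [← mul_div_assoc, div_le_div_iff₀ (by positivity) (by positivity)]
    calc (1 + 2 * C) * L ^ 2 * (36 * (y * n))
        ≤ (1 + 2 * C) * L ^ 2 * (36 * ((C * m) * (C * m))) := by gcongr
      _ = 1 / 4 * (144 * C ^ 2 * (L ^ 2 * (1 + 2 * C))) * m ^ 2 := by ring
      _ ≤ 1 / 4 * (4 * ((E + p) * p * D ^ 2)) * m ^ 2 :=
        mul_le_mul_of_nonneg_right (mul_le_mul_of_nonneg_left (hZ2.trans h7) (by norm_num))
          (by positivity)
      _ = _ := by ring
  linarith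

/-- Above a barrier, timelike geodesics with sufficiently large outgoing momentum emanate from the
singularity. -/
lemma IsBarrier.emanates (hμ : IsRegularData b μ) (hρ : IsCore b μ ρ) {C : ℝ} {N N' : ℝ → ℝ}
    (hN : IsBarrier μ ρ C N N') {ε : ℝ} (L : ℝ) (hε : 0 ≤ ε) (hε1 : ε ≤ 1) :
    Emanates b μ ε L := by
  obtain ⟨r₁, hr₁, hu₁⟩ := hN.untrapped
  have hm₁ := hμ.mass_pos' (hρ.mem hr₁)
  have hC : 0 < C := by
    have := hN.gap_le r₁ hr₁
    by_contra! h
    nlinarith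
  obtain ⟨t₁, ht₁, ht₁'⟩ := exists_between
    (show N r₁ < collapseTime μ r₁ - 2 / 3 * mass μ r₁ by linarith)
  have ht₀ : centralTime μ < t₁ := (hN.central_lt r₁ hr₁).trans ht₁
  -- The summand `1` gives `Z₀ ≤ Z₀²`, so `Z₀²` exceeds the thresholds of both
  -- `momentum_lower_bounds` and `drift_le`.
  set Z₀ := 1 + 144 * C ^ 2 * (L ^ 2 * (1 + 2 * C)) + 2 * C ^ 2 * (1 + L ^ 2) with hZ₀
  have hZa : 0 ≤ 144 * C ^ 2 * (L ^ 2 * (1 + 2 * C)) := by positivity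
  have hZb : 0 ≤ 2 * C ^ 2 * (1 + L ^ 2) := by positivity
  have hZ1 : 1 ≤ Z₀ := by linarith
  have hZpos : 0 < Z₀ := by linarith
  have hZsq : Z₀ ≤ Z₀ ^ 2 := by nlinarith
  have hZ2 : 144 * C ^ 2 * (L ^ 2 * (1 + 2 * C)) ≤ Z₀ ^ 2 := by linarith
  have hZ3 : 2 * C ^ 2 * (1 + L ^ 2) ≤ Z₀ ^ 2 := by linarith
  clear_value Z₀
  set p₀ := Z₀ / (4 * C) with hp₀
  have hp₀' : 0 < p₀ := by positivity
  set B := (t₁ - centralTime μ) / p₀ + 1 with hB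
  have hBpos : 0 < B := by
    have : 0 < t₁ - centralTime μ := by linarith
    positivity
  -- Chosen so that `p₁ (t₁ - N r₁) = Z₀ + 2B + 1`: the product then exceeds `Z₀ + 2s` at `s = T ≤
  -- B`.
  set p₁ := (Z₀ + 2 * B + 1) / (t₁ - N r₁) with hp₁
  have hD₁ : 0 < t₁ - N r₁ := by linarith
  have hp₁' : 0 < p₁ := by positivity
  have hstart : (t₁, r₁, p₁) ∈ outgoingRegion μ ρ :=
    ⟨hr₁, by simp only; linarith, ht₀, hp₁'⟩
  obtain ⟨T, hTB, z, hzT, hz, hesc⟩ := exists_flowLine hμ hρ hε (L := L) hstart hBpos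
  have hT := hTB.1
  have hTm : T ∈ Ioc 0 T := ⟨hT, le_rfl⟩
  have hu := hz.untrapped hμ hρ hε (by rw [hzT]; dsimp only; linarith)
  have hEpos : ∀ s ∈ Ioc 0 T, 0 < energy μ ε L (z s).2.1 (z s).1 (z s).2.2 := fun s hs =>
    energy_pos hε (hz s hs).1.2.2.2
  have bounds : ∀ s ∈ Ioc 0 T, Z₀ ≤ (energy μ ε L (z s).2.1 (z s).1 (z s).2.2 + (z s).2.2)
      * ((z s).1 - N (z s).2.1) → 0 < (z s).1 - N (z s).2.1 ∧
      (z s).1 - N (z s).2.1 ≤ C * mass μ (z s).2.1 ∧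
      energy μ ε L (z s).2.1 (z s).1 (z s).2.2 + (z s).2.2 ≤ 4 * (z s).2.2 ∧ p₀ ≤ (z s).2.2 := by
    intro s hs hZs
    have hm := (hz s hs).1
    have hE := hEpos s hs
    have hD : 0 < (z s).1 - N (z s).2.1 :=
      pos_of_mul_pos_right (hZpos.trans_le hZs) (by linarith [hm.2.2.2])
    have hDC : (z s).1 - N (z s).2.1 ≤ C * mass μ (z s).2.1 := by
      linarith [hN.gap_le _ hm.1, hm.2.1]
    exact ⟨hD, hDC, momentum_lower_bounds (hμ.mass_pos' (hρ.mem hm.1)) (mass_le_one hμ hρ hm.1)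
      (mass_lt_areaRadius hμ (hρ.mem hm.1) (hu s hs)) hD hDC hE hm.2.2.2 hε1
      (energy_sq hε rfl) hZpos hZ3 hZs⟩
  have hdD : ∀ s ∈ Ioc 0 T, HasDerivAt (fun u => (z u).1 - N (z u).2.1)
      (energy μ ε L (z s).2.1 (z s).1 (z s).2.2 - N' (z s).2.1 * ((z s).2.2
        / (areaRadius μ (z s).2.1 (z s).1 * radialLogRate μ (z s).2.1 (z s).1))) s := by
    intro s hs
    have h : HasDerivAt (N ∘ fun u => (z u).2.1) _ s :=
      (hN.hasDerivAt _ (hz s hs).1.1).comp s (hz.hasDerivAt_r hs)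
    exact (hz.hasDerivAt_t hs).sub h
  -- At a zero the derivative of this function is at most `ε - 2 < 0`; the slope `2` is there to
  -- beat `ε ≤ 1`.
  have key := pos_of_deriv_neg_at_zeros (T := T)
    (h := fun s => (energy μ ε L (z s).2.1 (z s).1 (z s).2.2 + (z s).2.2)
      * ((z s).1 - N (z s).2.1) - Z₀ - 2 * s) (h' := fun s => _)
    (fun s hs => (((((hz.hasDerivAt_energy hμ hρ hε hs).add (hz.hasDerivAt_p hs)).mul
      (hdD s hs)).sub_const Z₀).sub ((hasDerivAt_id s).const_mul 2))) ?_ ?_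
  · have hZs : ∀ s ∈ Ioc 0 T, Z₀ ≤ (energy μ ε L (z s).2.1 (z s).1 (z s).2.2 + (z s).2.2)
      * ((z s).1 - N (z s).2.1) := fun s hs => by linarith [key s hs, hs.1]
    have hztend := hz.tendsto_centralTime hμ hρ hε hT hu hp₀' (fun s hs =>
      (bounds s hs (hZs s hs)).2.2.2) (B := B) (by rw [hzT, hB]; field_simp; linarith) hesc
    refine hz.emanates hμ hρ hε hT hztend ?_
    refine tendsto_order.2 ⟨fun a ha => ?_, fun a ha => ?_⟩
    · filter_upwards [Ioc_mem_nhdsGT hT] with s hs using ha.trans (hz s hs).1.1.1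
    · by_cases hex : ∃ s ∈ Ioc 0 T, (z s).2.1 < a
      · obtain ⟨s₀, hs₀, hlt⟩ := hex
        filter_upwards [Ioc_mem_nhdsGT hs₀.1] with s hs
        exact (hz.monotoneOn_r hμ hρ ⟨hs.1, hs.2.trans hs₀.2⟩ hs₀ hs.2).trans_lt hlt
      · exfalso
        push Not at hex
        have hr₁' : (z T).2.1 = r₁ := by rw [hzT]
        have har : a ≤ r₁ := hr₁' ▸ hex T hTm
        have hin : ∀ x ∈ Icc a r₁, x ∈ Ioo 0 ρ := fun x hx =>
          ⟨ha.trans_le hx.1, hx.2.trans_lt hr₁.2⟩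
        -- On `[a, r₁]` the barrier has a minimum above `t₀`. As `t → t₀` with `t > N(r)`, the
        -- radius cannot remain in this interval.
        obtain ⟨x, hx, hmin⟩ := isCompact_Icc.exists_isMinOn (nonempty_Icc.2 har)
          (HasDerivAt.continuousOn fun x hx => hN.hasDerivAt x (hin x hx))
        obtain ⟨s, hs1, hs⟩ := ((hztend.eventually
          (gt_mem_nhds (hN.central_lt x (hin x hx)))).and (Ioc_mem_nhdsGT hT)).exists
        have h1 := (bounds s hs (hZs s hs)).1
        have h2 : N x ≤ N (z s).2.1 := hmin ⟨hex s hs, by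
          rw [← hr₁']; exact hz.monotoneOn_r hμ hρ hs hTm hs.2⟩
        linarith
  · rw [hzT]
    have h1 : p₁ * (t₁ - N r₁) = Z₀ + 2 * B + 1 := by rw [hp₁]; field_simp
    have h2 := energy_pos (μ := μ) (L := L) (r := r₁) (t := t₁) hε hp₁'
    have h3 := mul_pos h2 hD₁
    have := hTB.2
    dsimp only
    nlinarith
  · intro s hs h0 _
    have hs' := Ioo_subset_Ioc_self hs
    have hm := (hz s hs').1
    have hrb := hρ.mem hm.1
    have hZs : Z₀ ≤ (energy μ ε L (z s).2.1 (z s).1 (z s).2.2 + (z s).2.2)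
      * ((z s).1 - N (z s).2.1) := by linarith [hs.1]
    obtain ⟨hD, hDC, hEp, -⟩ := bounds s hs' hZs
    have hE := hEpos s hs'
    have hp := hm.2.2.2
    have hy : 0 < collapseTime μ (z s).2.1 - (z s).1 := by linarith [hm.2.1]
    have hn : collapseTime μ (z s).2.1 - (z s).1 ≤ collapseTime μ (z s).2.1 - N (z s).2.1 := by
      linarith
    have hnC := hN.gap_le _ hm.1
    have hdrift := drift_le (hμ.mass_pos' hrb) (mass_lt_areaRadius hμ hrb (hu s hs'))
      (trapping_lt_one hμ hrb (hu s hs')) hD hDC hy (hn.trans hnC)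
      (hy.trans_le hn) hnC hE hp (energy_sq hε rfl) hZpos hZ2 hZs hEp
    have hconv := radial_convexity hμ hρ hm.1 (sub_pos.1 hD) hm.2.1 (hN.rate_le _ hm.1)
    have hcausal := hN.causal _ hm.1
    have hΦ := mul_pos (areaRadius_pos hμ hrb hm.2.1) (radialLogRate_pos hμ hρ hm.1 hm.2.1)
    simp only [Pi.add_apply]
    generalize energy μ ε L (z s).2.1 (z s).1 (z s).2.2 = E at *
    generalize areaRadius μ (z s).2.1 (z s).1 * radialLogRate μ (z s).2.1 (z s).1 = Φ at *
    generalize L ^ 2 / areaRadius μ (z s).2.1 (z s).1 ^ 3 = l at *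
    generalize trapping μ (z s).2.1 (z s).1 = x at *
    generalize hubble μ (z s).2.1 (z s).1 = H at *
    generalize 36 * ((collapseTime μ (z s).2.1 - (z s).1)
      * (collapseTime μ (z s).2.1 - N (z s).2.1)) = W at *
    generalize (z s).1 - N (z s).2.1 = D at *
    generalize (z s).2.2 = p at *
    -- Convexity and the causality of the barrier bound `N' r'` below. Its term `-p H D`, multiplied
    -- by `E + p`, cancels the `H`-term of `(E' + p') D`.
    have h1 : p * (1 - H * D + D ^ 2 / W) ≤ N' (z s).2.1 * (p / Φ) := by
      have := hconv.trans hcausal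
      rw [mul_div_assoc', le_div_iff₀ hΦ]
      linarith [mul_le_mul_of_nonneg_left this hp.le]
    have h2 := mul_le_mul_of_nonneg_left h1 (by linarith : 0 ≤ E + p)
    have h3 : (E + p) * p * D ^ 2 / W = (E + p) * (p * (D ^ 2 / W)) := by ring
    rw [h3] at hdrift
    linarith

end Barriers

section Asymptotics

/-! ### The asymptotics of the collapse time at the centre -/

variable {b : ℝ} {μ : ℝ → ℝ}

/-- A filter at which a function has a definite limiting behaviour. -/
def IsDefinite (l : Filter ℝ) : Prop := l = atTop ∨ l = atBot ∨ ∃ c, l = 𝓝 c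

/-- The `k`-th derivative of the density on `[0, b]`. -/
def densityDeriv (b : ℝ) (μ : ℝ → ℝ) (k : ℕ) : ℝ → ℝ := iteratedDerivWithin k μ (Icc 0 b)

lemma hasDerivAt_densityDeriv (hμ : IsRegularData b μ) {k : ℕ} (hk : k < 3) {r : ℝ}
    (hr : r ∈ Ioo 0 b) : HasDerivAt (densityDeriv b μ k) (densityDeriv b μ (k + 1) r) r := by
  have hun := uniqueDiffOn_Icc hμ.radius_pos
  have h := hμ.contDiffOn.differentiableOn_iteratedDerivWithin (m := k) (by exact_mod_cast hk) hun
  have h1 := (h r (Ioo_subset_Icc_self hr)).hasDerivWithinAt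
  rw [← iteratedDerivWithin_succ] at h1
  exact h1.hasDerivAt (Icc_mem_nhds hr.1 hr.2)

lemma tendsto_densityDeriv (hμ : IsRegularData b μ) {k : ℕ} (hk : k ≤ 3) :
    Tendsto (densityDeriv b μ k) (𝓝[>] 0) (𝓝 (densityDeriv b μ k 0)) := by
  have hun := uniqueDiffOn_Icc hμ.radius_pos
  have h := hμ.contDiffOn.continuousOn_iteratedDerivWithin (m := k) (by exact_mod_cast hk) hun
  exact (h 0 ⟨le_rfl, hμ.radius_pos.le⟩).mono_left
    (nhdsWithin_le_of_mem (mem_of_superset (Ioo_mem_nhdsGT hμ.radius_pos) Ioo_subset_Icc_self))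

/-- Step of a l'Hôpital argument: a quotient by a function tending to `0⁺`. -/
lemma exists_isDefinite_div {f g f' g' : ℝ → ℝ} {a : ℝ} (hf : Tendsto f (𝓝[>] 0) (𝓝 a))
    (hg : Tendsto g (𝓝[>] 0) (𝓝 0)) (hg0 : ∀ᶠ r in 𝓝[>] 0, 0 < g r)
    (hff' : ∀ᶠ r in 𝓝[>] 0, HasDerivAt f (f' r) r)
    (hgg' : ∀ᶠ r in 𝓝[>] 0, HasDerivAt g (g' r) r) (hg' : ∀ᶠ r in 𝓝[>] 0, g' r ≠ 0)
    (h : ∃ l, IsDefinite l ∧ Tendsto (fun r => f' r / g' r) (𝓝[>] 0) l) :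
    ∃ l, IsDefinite l ∧ Tendsto (fun r => f r / g r) (𝓝[>] 0) l := by
  have hinv : Tendsto (fun r => (g r)⁻¹) (𝓝[>] 0) atTop :=
    tendsto_inv_nhdsGT_zero.comp (tendsto_nhdsWithin_iff.2 ⟨hg, hg0⟩)
  rcases lt_trichotomy a 0 with ha | ha | ha
  · exact ⟨atBot, Or.inr (Or.inl rfl), by
      simpa only [div_eq_mul_inv] using hf.neg_mul_atTop ha hinv⟩
  · obtain ⟨l, hl, ht⟩ := h
    subst ha
    exact ⟨l, hl, HasDerivAt.lhopital_zero_nhdsGT hff' hgg' hg' hf hg ht⟩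
  · exact ⟨atTop, Or.inl rfl, by simpa only [div_eq_mul_inv] using hf.pos_mul_atTop ha hinv⟩

lemma tendsto_monomial_zero (c : ℝ) {n : ℕ} (hn : n ≠ 0) :
    Tendsto (fun r : ℝ => c * r ^ n) (𝓝[>] 0) (𝓝 0) :=
  (Continuous.tendsto' (by fun_prop) 0 0 (by simp [hn])).mono_left nhdsWithin_le_nhds

lemma eventually_monomial_pos {c : ℝ} (hc : 0 < c) (n : ℕ) :
    ∀ᶠ r in 𝓝[>] (0 : ℝ), 0 < c * r ^ n := by
  filter_upwards [self_mem_nhdsWithin] with r (hr : 0 < r)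
  positivity

/-- The derivative of `3m - r³ μ` is `-r³ μ'`, so l'Hôpital reduces the quotient to `-μ'/(6r²)`,
then `-μ''/(12r)`, then `-μ'''/12`. The reduction stops early if a numerator has a nonzero limit;
otherwise continuity of `μ'''` decides. -/
lemma exists_isDefinite_shear (hμ : IsRegularData b μ) :
    ∃ l, IsDefinite l ∧
      Tendsto (fun r => (3 * mass μ r - r ^ 3 * μ r) / r ^ 6) (𝓝[>] 0) l := by
  have hI := Ioo_mem_nhdsGT hμ.radius_pos
  have h3 : ∃ l, IsDefinite l ∧
      Tendsto (fun r => -densityDeriv b μ 3 r / 12) (𝓝[>] 0) l :=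
    ⟨_, Or.inr (Or.inr ⟨_, rfl⟩), (tendsto_densityDeriv hμ le_rfl).neg.div_const 12⟩
  have h2 : ∃ l, IsDefinite l ∧
      Tendsto (fun r => -densityDeriv b μ 2 r / (12 * r ^ 1)) (𝓝[>] 0) l := by
    refine exists_isDefinite_div (f' := fun r => -densityDeriv b μ 3 r) (g' := fun _ => 12)
      (tendsto_densityDeriv hμ (by norm_num)).neg (tendsto_monomial_zero 12 one_ne_zero)
      (eventually_monomial_pos (by norm_num) 1) ?_ ?_ (by simp) h3
    · filter_upwards [hI] with r hr using (hasDerivAt_densityDeriv hμ (by norm_num) hr).neg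
    · exact Eventually.of_forall fun r => by simpa using (hasDerivAt_pow 1 r).const_mul (12 : ℝ)
  have h1 : ∃ l, IsDefinite l ∧
      Tendsto (fun r => -densityDeriv b μ 1 r / (6 * r ^ 2)) (𝓝[>] 0) l := by
    refine exists_isDefinite_div (f' := fun r => -densityDeriv b μ 2 r)
      (g' := fun r => 12 * r ^ 1)
      (tendsto_densityDeriv hμ (by norm_num)).neg (tendsto_monomial_zero 6 two_ne_zero)
      (eventually_monomial_pos (by norm_num) 2) ?_ ?_ ?_ h2
    · filter_upwards [hI] with r hr using (hasDerivAt_densityDeriv hμ (by norm_num) hr).neg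
    · exact Eventually.of_forall fun r =>
        ((hasDerivAt_pow 2 r).const_mul (6 : ℝ)).congr_deriv (by push_cast; ring)
    · exact (eventually_monomial_pos (by norm_num) 1).mono fun r h => h.ne'
  obtain ⟨l, hl, ht⟩ := h1
  refine ⟨l, hl, HasDerivAt.lhopital_zero_nhdsGT (f' := fun r => -(r ^ 3 * densityDeriv b μ 1 r))
    (g' := fun r => 6 * r ^ 5) ?_ ?_ ?_ ?_ ?_ ?_⟩
  · filter_upwards [hI] with r hr
    have hd := hasDerivAt_densityDeriv hμ (k := 0) (by norm_num) hr
    rw [show densityDeriv b μ 0 = μ from funext fun x => by simp [densityDeriv]] at hd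
    refine (((hasDerivAt_mass hμ hr).const_mul 3).sub ((hasDerivAt_pow 3 r).mul hd)).congr_deriv ?_
    push_cast
    ring
  · exact Eventually.of_forall fun r => by simpa using hasDerivAt_pow 6 r
  · exact (eventually_monomial_pos (by norm_num) 5).mono fun r h => h.ne'
  · have := ((tendsto_mass_zero hμ).const_mul 3).sub
      ((tendsto_monomial_zero 1 three_ne_zero).mul (tendsto_density hμ))
    simpa using this
  · simpa using tendsto_monomial_zero 1 (n := 6) (by norm_num)
  · refine ht.congr' ?_
    filter_upwards [self_mem_nhdsWithin] with r (hr : 0 < r)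
    field_simp

/-- Either `t_c'(r) / r² → ∞` as `r → 0⁺`, or `t_c'(r) / r²` has a finite limit. -/
lemma collapseRate_dichotomy (hμ : IsRegularData b μ) :
    Tendsto (fun r => collapseRate μ r / r ^ 2) (𝓝[>] 0) atTop ∨
      ∃ c, Tendsto (fun r => collapseRate μ r / r ^ 2) (𝓝[>] 0) (𝓝 c) := by
  obtain ⟨l, hl, ht⟩ := exists_isDefinite_shear hμ
  have h0 := hμ.central_density_pos
  have hq : Tendsto (fun r => collapseTime μ r / (2 * (mass μ r / r ^ 3))) (𝓝[>] 0)
      (𝓝 (centralTime μ / (2 * (μ 0 / 3)))) :=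
    (tendsto_collapseTime hμ).div ((tendsto_mass_div hμ).const_mul 2) (by positivity)
  have hpos : 0 < centralTime μ / (2 * (μ 0 / 3)) := by
    have := centralTime_pos hμ
    positivity
  have heq : (fun r => (3 * mass μ r - r ^ 3 * μ r) / r ^ 6
      * (collapseTime μ r / (2 * (mass μ r / r ^ 3)))) =ᶠ[𝓝[>] 0]
      fun r => collapseRate μ r / r ^ 2 := by
    filter_upwards [Ioo_mem_nhdsGT hμ.radius_pos] with r hr
    have := hμ.mass_pos' hr
    have := hr.1
    unfold collapseRate
    field_simp
  rcases hl with rfl | rfl | ⟨c, rfl⟩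
  · exact Or.inl ((ht.atTop_mul_pos hpos hq).congr' heq)
  -- A limit `-∞` is excluded by the condition against shell crossings.
  · exfalso
    obtain ⟨r, hr1, hr⟩ := ((ht.eventually_lt_atBot 0).and
      (Ioo_mem_nhdsGT hμ.radius_pos)).exists
    have h1 := hμ.no_shell_crossing r (Ioo_subset_Ioc_self hr)
    have : 0 ≤ (3 * mass μ r - r ^ 3 * μ r) / r ^ 6 := by
      have := hr.1
      refine div_nonneg ?_ (by positivity)
      linarith [h1, show r * (r ^ 2 * μ r) = r ^ 3 * μ r by ring]
    linarith
  · exact Or.inr ⟨_, (ht.mul hq).congr' heq⟩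

lemma tendsto_collapseTime_sub_div (hμ : IsRegularData b μ) {c : ℝ}
    (h : Tendsto (fun r => collapseRate μ r / r ^ 2) (𝓝[>] 0) (𝓝 c)) :
    Tendsto (fun r => (collapseTime μ r - centralTime μ) / r ^ 3) (𝓝[>] 0) (𝓝 (c / 3)) := by
  refine HasDerivAt.lhopital_zero_nhdsGT (f' := collapseRate μ) (g' := fun r => 3 * r ^ 2)
    ?_ ?_ ?_ ?_ ?_ ?_
  · filter_upwards [Ioo_mem_nhdsGT hμ.radius_pos] with r hr
    exact (hasDerivAt_collapseTime hμ hr).sub_const _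
  · exact Eventually.of_forall fun r => by simpa using hasDerivAt_pow 3 r
  · exact (eventually_monomial_pos (by norm_num) 2).mono fun r h => h.ne'
  · simpa using (tendsto_collapseTime hμ).sub_const (centralTime μ)
  · simpa using tendsto_monomial_zero 1 (n := 3) (by norm_num)
  · refine (h.div_const 3).congr' ?_
    filter_upwards [self_mem_nhdsWithin] with r (hr : 0 < r)
    field_simp

/-- If `t_c'(r) / r² → ∞` then the curve `R = 4 m` is a barrier. -/
lemma exists_barrier_of_tendsto_atTop (hμ : IsRegularData b μ)
    (h : Tendsto (fun r => collapseRate μ r / r ^ 2) (𝓝[>] 0) atTop) :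
    ∃ ρ, IsCore b μ ρ ∧ ∃ C N N', IsBarrier μ ρ C N N' := by
  obtain ⟨ρ, hρ⟩ := exists_isCore hμ
  -- With `w = r² μ = m'`, the bound `t_c' ≥ (40/3) w` is exactly causality of `R = 4m`, namely
  -- `(4/3) w + t_c'/2 ≤ t_c' - (16/3) w`. The other conditions need less.
  have hev : ∀ᶠ r in 𝓝[>] 0, 40 / 3 * (r ^ 2 * μ r) ≤ collapseRate μ r := by
    filter_upwards [h.eventually_ge_atTop (40 / 3 * (μ 0 + 1)),
      (tendsto_density hμ).eventually (gt_mem_nhds (lt_add_one (μ 0))), self_mem_nhdsWithin]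
      with r h1 h2 (hr : 0 < r)
    rw [le_div_iff₀ (by positivity)] at h1
    nlinarith [pow_pos hr 2]
  obtain ⟨u, hu, hsub⟩ := mem_nhdsGT_iff_exists_Ioo_subset.1 hev
  have hu' : 0 < u := hu
  have hρ0 := hρ.pos
  have hσ : 0 < min u ρ := lt_min hu' hρ0
  have hcore := hρ.mono hσ (min_le_right _ _)
  have hrate : ∀ r ∈ Ioo 0 (min u ρ), 40 / 3 * (r ^ 2 * μ r) ≤ collapseRate μ r := fun r hr =>
    hsub ⟨hr.1, hr.2.trans_le (min_le_left _ _)⟩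
  have hw : ∀ r ∈ Ioo 0 (min u ρ), 0 < r ^ 2 * μ r := fun r hr => by
    have := hcore.density_pos r hr
    have := hr.1
    positivity
  have hd : ∀ r ∈ Ioo 0 (min u ρ), HasDerivAt (fun r => collapseTime μ r - 16 / 3 * mass μ r)
      (collapseRate μ r - 16 / 3 * (r ^ 2 * μ r)) r := fun r hr =>
    (hasDerivAt_collapseTime hμ (hcore.mem hr)).sub
      ((hasDerivAt_mass hμ (hcore.mem hr)).const_mul _)
  refine ⟨min u ρ, hcore, 16 / 3, fun r => collapseTime μ r - 16 / 3 * mass μ r,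
    fun r => collapseRate μ r - 16 / 3 * (r ^ 2 * μ r), hd, ?_, ?_, ?_, ?_, ?_⟩
  · have hmono : StrictMonoOn (fun r => collapseTime μ r - 16 / 3 * mass μ r)
        (Ioo 0 (min u ρ)) := by
      refine strictMonoOn_of_deriv_pos (convex_Ioo _ _) (HasDerivAt.continuousOn hd) ?_
      rw [interior_Ioo]
      intro r hr
      rw [(hd r hr).deriv]
      linarith [hrate r hr, hw r hr]
    intro r hr
    have hr2 : r / 2 ∈ Ioo 0 (min u ρ) := ⟨by linarith [hr.1], by linarith [hr.1, hr.2]⟩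
    refine lt_of_le_of_lt ?_ (hmono hr2 hr (by linarith [hr.1]))
    have ht := (tendsto_collapseTime hμ).sub ((tendsto_mass_zero hμ).const_mul (16 / 3))
    rw [mul_zero, sub_zero] at ht
    refine le_of_tendsto ht ?_
    filter_upwards [Ioo_mem_nhdsGT hr2.1] with x hx
    exact (hmono ⟨hx.1, hx.2.trans hr2.2⟩ hr2 hx.2).le
  · intro r hr
    linarith
  · intro r hr
    have hm := hμ.mass_pos' (hcore.mem hr)
    have : 3 * massRate μ r * (collapseTime μ r - (collapseTime μ r - 16 / 3 * mass μ r))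
        = 16 / 3 * (r ^ 2 * μ r) := by
      unfold massRate
      field_simp
      ring
    rw [this]
    linarith [hrate r hr, hw r hr]
  · intro r hr
    have hm := hμ.mass_pos' (hcore.mem hr)
    have hlt : collapseTime μ r - 16 / 3 * mass μ r < collapseTime μ r := by linarith
    have hR : areaRadius μ r (collapseTime μ r - 16 / 3 * mass μ r) = 4 * mass μ r := by
      have hc := areaRadius_cube hμ (hcore.mem hr) hlt
      refine (pow_left_inj₀ (areaRadius_pos hμ (hcore.mem hr) hlt).le (by positivity)
        (by norm_num : 3 ≠ 0)).1 ?_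
      rw [hc]
      ring
    have : 4 * mass μ r * radialLogRate μ r (collapseTime μ r - 16 / 3 * mass μ r)
        = 4 / 3 * (r ^ 2 * μ r) + collapseRate μ r / 2 := by
      unfold radialLogRate massRate
      field_simp
      ring
    rw [hR, this]
    linarith [hrate r hr, hw r hr]
  · refine ⟨min u ρ / 2, ⟨by positivity, by linarith⟩, ?_⟩
    have := hμ.mass_pos' (hcore.mem (r := min u ρ / 2) ⟨by positivity, by linarith⟩)
    linarith

/-! ### Radial null geodesics as barriers -/

variable {δ : ℝ} {t r : ℝ → ℝ}

/-- Along an emanating radial null geodesic, `dt/ds` is positive close to the centre: it vanishes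
everywhere if it vanishes anywhere, and then `r` is constant. -/
lemma IsGeodesic.deriv_t_pos_of_null (hμ : IsRegularData b μ) {ρ : ℝ} (hρ : IsCore b μ ρ)
    (hg : IsGeodesic b μ 0 0 δ t r) (ht : ∀ s ∈ Ioo 0 δ, 0 ≤ deriv t s)
    (hr0 : Tendsto r (𝓝[>] 0) (𝓝 0)) (hrρ : ∀ s ∈ Ioo 0 δ, r s ∈ Ioo 0 ρ) :
    ∀ s ∈ Ioo 0 δ, 0 < deriv t s := by
  have hΦ : ∀ s ∈ Ioo 0 δ, 0 < areaRadius_r μ (r s) (t s) := fun s hs => by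
    rw [areaRadius_r_eq hμ (hg.r_mem s hs) (hg.t_mem s hs).2]
    exact mul_pos (areaRadius_pos hμ (hg.r_mem s hs) (hg.t_mem s hs).2)
      (radialLogRate_pos hμ hρ (hrρ s hs) (hg.t_mem s hs).2)
  have hnorm : ∀ s ∈ Ioo 0 δ, (areaRadius_r μ (r s) (t s) * deriv r s) ^ 2 = deriv t s ^ 2 :=
    fun s hs => by
      have := hg.eq_norm s hs
      simp only [ne_eq, OfNat.ofNat_ne_zero, not_false_eq_true, zero_pow, zero_div, add_zero,
        neg_zero] at this
      linarith
  -- In the radial null case the `t`-equation becomes `t'' = -H t'²`, which is linear homogeneous in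
  -- `t'` with coefficient `-H t'`.
  have hdd : ∀ s ∈ Ioo 0 δ, HasDerivAt (deriv t)
      (-(hubble μ (r s) (t s) * deriv t s) * deriv t s) s := by
    intro s hs
    have hC1 : ContDiffOn ℝ 1 (deriv t) (Ioo 0 δ) := by
      have := hg.contDiffOn_t
      rw [show (2 : WithTop ℕ∞) = 1 + 1 by norm_num,
        contDiffOn_succ_iff_deriv_of_isOpen isOpen_Ioo] at this
      exact this.2.2
    have hd := ((hC1.contDiffAt (isOpen_Ioo.mem_nhds hs)).differentiableAt
      one_ne_zero).hasDerivAt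
    refine hd.congr_deriv ?_
    have heq := hg.eq_t s hs
    simp only [ne_eq, OfNat.ofNat_ne_zero, not_false_eq_true, zero_pow, zero_div, mul_zero,
      add_zero] at heq
    have hrt : areaRadius_rt μ (r s) (t s) = hubble μ (r s) (t s)
        * areaRadius_r μ (r s) (t s) := by
      have := radialLogRate_pos hμ hρ (hrρ s hs) (hg.t_mem s hs).2
      rw [areaRadius_rt_eq hμ (hg.r_mem s hs) (hg.t_mem s hs).2,
        areaRadius_r_eq hμ (hg.r_mem s hs) (hg.t_mem s hs).2, hubble]
      field_simp
    rw [hrt] at heq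
    linear_combination heq + hubble μ (r s) (t s) * hnorm s hs * (-1)
  have hHc : ContinuousOn (fun s => hubble μ (r s) (t s) * deriv t s) (Ioo 0 δ) := by
    have hrc : ContinuousOn r (Ioo 0 δ) := hg.contDiffOn_r.continuousOn
    have hmaps : MapsTo r (Ioo 0 δ) (Ioo 0 b) := hg.r_mem
    have hc := (contDiffOn_collapseTime hμ).continuousOn.comp hrc hmaps
    have hm := (contDiffOn_massRate hμ).continuousOn.comp hrc hmaps
    have hk := (contDiffOn_collapseRate hμ).continuousOn.comp hrc hmaps
    have hy := hc.sub hg.contDiffOn_t.continuousOn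
    have hy0 : ∀ s ∈ Ioo 0 δ, 0 < collapseTime μ (r s) - t s := fun s hs => by
      linarith [(hg.t_mem s hs).2]
    refine ContinuousOn.mul (ContinuousOn.div (ContinuousOn.add ?_ ?_) (ContinuousOn.add hm ?_) ?_)
      (HasDerivAt.continuousOn hdd)
    · exact (continuousOn_const.mul hm).div hy fun s hs => (hy0 s hs).ne'
    · exact (continuousOn_const.mul hk).div (hy.pow 2) fun s hs => (pow_pos (hy0 s hs) 2).ne'
    · exact (continuousOn_const.mul hk).div hy fun s hs => (hy0 s hs).ne'
    · exact fun s hs => (radialLogRate_pos hμ hρ (hrρ s hs) (hg.t_mem s hs).2).ne'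
  intro s hs
  refine lt_of_le_of_ne (ht s hs) fun h0 => ?_
  have hzero : ∀ x ∈ Ioc 0 s, deriv t x = 0 := by
    intro x hx
    have hsub : Icc x s ⊆ Ioo 0 δ := fun w hw => ⟨hx.1.trans_le hw.1, hw.2.trans_lt hs.2⟩
    -- Grönwall's inequality propagates zeros forwards, so it is applied after the reflection `u ↦
    -- -u`.
    obtain ⟨K, hK⟩ := (isCompact_Icc (a := x) (b := s)).exists_bound_of_continuousOn
      (hHc.mono hsub)
    have hneg : ∀ u ∈ Icc (-s) (-x), -u ∈ Icc x s := fun u hu =>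
      ⟨by linarith [hu.2], by linarith [hu.1]⟩
    have hd : ∀ u ∈ Icc (-s) (-x), HasDerivAt (fun u => deriv t (-u))
        (hubble μ (r (-u)) (t (-u)) * deriv t (-u) * deriv t (-u)) u := fun u hu => by
      have h := HasDerivAt.scomp u (hdd (-u) (hsub (hneg u hu))) (hasDerivAt_neg u)
      refine h.congr_deriv ?_
      simp
    have := eq_zero_of_abs_deriv_le_mul_abs_self_of_eq_zero_right (K := K)
      (HasDerivAt.continuousOn hd) (fun u hu => (hd u (Ico_subset_Icc_self hu)).hasDerivWithinAt)
      (by simpa using h0.symm) (fun u hu => by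
        rw [norm_mul]
        exact mul_le_mul_of_nonneg_right (hK _ (hneg u (Ico_subset_Icc_self hu)))
          (norm_nonneg _)) (-x) ⟨by linarith [hx.2], le_rfl⟩
    simpa using this
  have hr' : ∀ x ∈ Ioc 0 s, deriv r x = 0 := fun x hx => by
    have hxδ : x ∈ Ioo 0 δ := ⟨hx.1, hx.2.trans_lt hs.2⟩
    have h1 := hnorm x hxδ
    rw [hzero x hx] at h1
    have h2 := pow_eq_zero_iff (two_ne_zero) |>.1 (h1.trans (by norm_num))
    exact (mul_eq_zero.1 h2).resolve_left (hΦ x hxδ).ne'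
  have hanti := monotoneOn_Ioc_of_hasDerivAt (T := s) (f := fun x => -r x) (f' := fun _ => 0)
    (fun x hx => ((hg.hasDerivAt_r ⟨hx.1, hx.2.trans_lt hs.2⟩).neg.congr_deriv
      (by rw [hr' x hx, neg_zero]))) fun _ _ => le_rfl
  refine absurd (ge_of_tendsto hr0 (b := r s) ?_) (not_le.2 (hg.r_mem s hs).1)
  filter_upwards [Ioc_mem_nhdsGT hs.1] with x hx
  have := hanti hx ⟨hs.1, le_rfl⟩ hx.2
  simpa using this

/-- An emanating radial null geodesic is a graph `t = N(r)` with `N' = R_{,r}`. -/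
lemma exists_null_graph (hμ : IsRegularData b μ) (hem : RadialNullEmanates b μ) :
    ∃ ρ, IsCore b μ ρ ∧ ∃ N : ℝ → ℝ, (∀ x ∈ Ioo 0 ρ, centralTime μ < N x ∧
      N x < collapseTime μ x ∧
      HasDerivAt N (areaRadius μ x (N x) * radialLogRate μ x (N x)) x) ∧
      ∀ η > 0, ∃ x ∈ Ioo 0 η, 2 / 3 * mass μ x < collapseTime μ x - N x := by
  obtain ⟨δ₀, t, r, hδ₀, hg₀, ht, -, -, hr0, ht0⟩ := hem
  obtain ⟨ρ, hρ⟩ := exists_isCore hμ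
  obtain ⟨δ, hδ, hsub⟩ := mem_nhdsGT_iff_exists_Ioo_subset.1 (inter_mem
    (hr0.eventually (gt_mem_nhds hρ.pos)) (Ioo_mem_nhdsGT hδ₀))
  have hδ' : 0 < δ := hδ
  have hI : Ioo 0 δ ⊆ Ioo 0 δ₀ := fun s hs => (hsub hs).2
  have hg : IsGeodesic b μ 0 0 δ t r :=
    ⟨hg₀.contDiffOn_t.mono hI, hg₀.contDiffOn_r.mono hI, fun s hs => hg₀.r_mem s (hI hs),
      fun s hs => hg₀.t_mem s (hI hs), fun s hs => hg₀.eq_t s (hI hs),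
      fun s hs => hg₀.eq_r s (hI hs), fun s hs => hg₀.eq_norm s (hI hs)⟩
  have hrρ : ∀ s ∈ Ioo 0 δ, r s ∈ Ioo 0 ρ := fun s hs => ⟨(hg.r_mem s hs).1, (hsub hs).1⟩
  have htpos := hg.deriv_t_pos_of_null hμ hρ (fun s hs => ht s (hI hs)) hr0 hrρ
  have hΦ : ∀ s ∈ Ioo 0 δ, 0 < areaRadius_r μ (r s) (t s) := fun s hs => by
    rw [areaRadius_r_eq hμ (hg.r_mem s hs) (hg.t_mem s hs).2]
    exact mul_pos (areaRadius_pos hμ (hg.r_mem s hs) (hg.t_mem s hs).2)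
      (radialLogRate_pos hμ hρ (hrρ s hs) (hg.t_mem s hs).2)
  have hnorm : ∀ s ∈ Ioo 0 δ, (areaRadius_r μ (r s) (t s) * deriv r s) ^ 2 = deriv t s ^ 2 :=
    fun s hs => by
      have := hg.eq_norm s hs
      simp only [ne_eq, OfNat.ofNat_ne_zero, not_false_eq_true, zero_pow, zero_div, add_zero,
        neg_zero] at this
      linarith
  have hrpos : ∀ s ∈ Ioo 0 δ, 0 < deriv r s := by
    have hne : ∀ s ∈ Ioo 0 δ, deriv r s ≠ 0 := fun s hs h0 => by
      have h1 := hnorm s hs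
      rw [h0, mul_zero] at h1
      nlinarith [htpos s hs]
    -- By Darboux `r'` has a constant sign; a negative sign is incompatible with `0 < r → 0` as `s →
    -- 0⁺`.
    rcases hasDerivWithinAt_forall_lt_or_forall_gt_of_forall_ne (convex_Ioo 0 δ)
      (fun s hs => (hg.hasDerivAt_r hs).hasDerivWithinAt) hne with h | h
    · exfalso
      have hmid : δ / 2 ∈ Ioo 0 δ := ⟨by linarith, by linarith⟩
      have hanti : AntitoneOn r (Ioo 0 δ) := by
        refine antitoneOn_of_deriv_nonpos (convex_Ioo 0 δ)
          (HasDerivAt.continuousOn fun s hs => hg.hasDerivAt_r hs) ?_ ?_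
        · rw [interior_Ioo]
          exact fun s hs => (hg.hasDerivAt_r hs).differentiableAt.differentiableWithinAt
        · rw [interior_Ioo]
          exact fun s hs => (h s hs).le
      refine absurd (ge_of_tendsto hr0 (b := r (δ / 2)) ?_) (not_le.2 (hg.r_mem _ hmid).1)
      filter_upwards [Ioo_mem_nhdsGT hmid.1] with s hs
      exact hanti ⟨hs.1, hs.2.trans hmid.2⟩ hmid hs.2.le
    · exact h
  -- The graph over `t` serves only to give the strict inequality `t₀ < t(s)`.
  obtain ⟨w, hwt, -⟩ := exists_graph (fun s hs => hg.hasDerivAt_t hs)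
    (fun s hs => hg.hasDerivAt_r hs) htpos ht0
  obtain ⟨N, hN, hNsurj⟩ := exists_graph (fun s hs => hg.hasDerivAt_r hs)
    (fun s hs => hg.hasDerivAt_t hs) hrpos hr0
  have hmid : δ / 2 ∈ Ioo 0 δ := ⟨by linarith, by linarith⟩
  have hgood : ∀ s ∈ Ioo 0 δ, centralTime μ < N (r s) ∧ N (r s) < collapseTime μ (r s) ∧
      HasDerivAt N (areaRadius μ (r s) (N (r s)) * radialLogRate μ (r s) (N (r s))) (r s) := by
    intro s hs
    obtain ⟨-, h1, h2⟩ := hN s hs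
    rw [h1]
    refine ⟨(hwt s hs).1, (hg.t_mem s hs).2, h2.congr_deriv ?_⟩
    rw [← areaRadius_r_eq hμ (hg.r_mem s hs) (hg.t_mem s hs).2, div_eq_iff (hrpos s hs).ne']
    exact ((pow_left_inj₀ (mul_pos (hΦ s hs) (hrpos s hs)).le (htpos s hs).le two_ne_zero).1
      (hnorm s hs)).symm
  refine ⟨r (δ / 2), hρ.mono (hg.r_mem _ hmid).1 (hrρ _ hmid).2.le, N, fun x hx => ?_,
    fun η hη => ?_⟩
  · obtain ⟨s, hs, rfl⟩ := hNsurj _ hmid x ⟨hx.1, hx.2.le⟩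
    exact hgood s ⟨hs.1, hs.2.trans_lt hmid.2⟩
  · obtain ⟨δ₂, hδ₂, hsub₂⟩ := mem_nhdsGT_iff_exists_Ioo_subset.1 (inter_mem
      (hr0.eventually (gt_mem_nhds hη)) (Ioo_mem_nhdsGT hδ'))
    have hle : min δ₂ δ ≤ δ := min_le_right _ _
    have hmin : 0 < min δ₂ δ := lt_min hδ₂ hδ'
    obtain ⟨s, hs, hu⟩ := hg.exists_untrapped hμ le_rfl (fun s hs => ht s (hI hs)) hr0 hmin hle
    have hsδ : s ∈ Ioo 0 δ := ⟨hs.1, hs.2.trans_le hle⟩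
    refine ⟨r s, ⟨(hg.r_mem s hsδ).1, (hsub₂ ⟨hs.1, hs.2.trans_le (min_le_left _ _)⟩).1⟩, ?_⟩
    rwa [(hN s hsδ).2.1]

/-- If `t_c'(r) / r²` has a finite limit, an emanating radial null geodesic is a barrier. -/
lemma exists_barrier_of_tendsto_nhds (hμ : IsRegularData b μ) {c : ℝ}
    (h : Tendsto (fun r => collapseRate μ r / r ^ 2) (𝓝[>] 0) (𝓝 c))
    (hem : RadialNullEmanates b μ) :
    ∃ ρ, IsCore b μ ρ ∧ ∃ C N N', IsBarrier μ ρ C N N' := by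
  obtain ⟨ρ, hρ, N, hN, hun⟩ := exists_null_graph hμ hem
  have h0 := hμ.central_density_pos
  have htc := tendsto_collapseTime_sub_div hμ h
  have hmass := tendsto_mass_div hμ
  -- If `c ≤ 0`, then `t_c - t₀ < (2/3) m` near the centre. But the ray has untrapped points there,
  -- where `(2/3) m < t_c - N < t_c - t₀`.
  have hc : 0 < c := by
    by_contra! hc
    have hlt : c / 3 < 2 / 3 * (μ 0 / 3) := by
      have : 0 < μ 0 / 3 := by positivity
      linarith
    have hev := htc.eventually_lt (hmass.const_mul (2 / 3)) hlt
    obtain ⟨u, hu, hsub⟩ := mem_nhdsGT_iff_exists_Ioo_subset.1 hev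
    obtain ⟨x, hx, hxu⟩ := hun (min u ρ) (lt_min hu hρ.pos)
    have hxρ : x ∈ Ioo 0 ρ := ⟨hx.1, hx.2.trans_le (min_le_right _ _)⟩
    have h1 : (collapseTime μ x - centralTime μ) / x ^ 3 < 2 / 3 * (mass μ x / x ^ 3) :=
      hsub ⟨hx.1, hx.2.trans_le (min_le_left _ _)⟩
    have hx3 : 0 < x ^ 3 := pow_pos hx.1 3
    rw [← mul_div_assoc, div_lt_div_iff_of_pos_right hx3] at h1
    linarith [(hN x hxρ).1]
  -- Since `t_c - t₀ ~ c r³/3` and `m ~ μ(0) r³/3`, any constant above `c/μ(0)` bounds the quotient.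
  have hgapev : ∀ᶠ r in 𝓝[>] 0,
      (collapseTime μ r - centralTime μ) / r ^ 3 < (c / μ 0 + 1) * (mass μ r / r ^ 3) := by
    refine htc.eventually_lt (hmass.const_mul (c / μ 0 + 1)) ?_
    have : (c / μ 0 + 1) * (μ 0 / 3) = c / 3 + μ 0 / 3 := by field_simp
    rw [this]
    linarith [h0]
  have hrateev : ∀ᶠ r in 𝓝[>] 0,
      3 * ((collapseTime μ r - centralTime μ) / r ^ 3) < 2 * (collapseRate μ r / r ^ 2) :=
    (htc.const_mul 3).eventually_lt (h.const_mul 2) (by linarith)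
  obtain ⟨u, hu, hsub⟩ := mem_nhdsGT_iff_exists_Ioo_subset.1 (hgapev.and hrateev)
  have hσ : 0 < min u ρ := lt_min hu hρ.pos
  have hcore := hρ.mono hσ (min_le_right _ _)
  have hmem : ∀ r ∈ Ioo 0 (min u ρ), r ∈ Ioo 0 ρ := fun r hr =>
    ⟨hr.1, hr.2.trans_le (min_le_right _ _)⟩
  have hev : ∀ r ∈ Ioo 0 (min u ρ), _ := fun r hr =>
    hsub ⟨hr.1, hr.2.trans_le (min_le_left _ _)⟩
  refine ⟨min u ρ, hcore, c / μ 0 + 1, N,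
    fun x => areaRadius μ x (N x) * radialLogRate μ x (N x), fun r hr => (hN r (hmem r hr)).2.2,
    fun r hr => (hN r (hmem r hr)).1, fun r hr => ?_, fun r hr => ?_, fun _ _ => le_rfl, ?_⟩
  · have h1 := (hev r hr).1
    have hr3 : 0 < r ^ 3 := pow_pos hr.1 3
    rw [← mul_div_assoc, div_lt_div_iff_of_pos_right hr3] at h1
    linarith [(hN r (hmem r hr)).1]
  · have h1 := (hev r hr).2
    have hr0 := hr.1
    -- Absence of shell crossings gives `m'/(3m) ≤ 1/r`. The rate condition then follows from `3
    -- (t_c - t₀)/r ~ c r²` and `2 t_c' ~ 2c r²`, where `c > 0` is needed.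
    have hg : massRate μ r ≤ 1 / r := by
      have hm := hμ.mass_pos' (hcore.mem hr)
      have hns := hμ.no_shell_crossing r (Ioo_subset_Ioc_self (hcore.mem hr))
      unfold massRate
      rw [div_le_div_iff₀ (by positivity) hr0]
      linarith
    have hgap : collapseTime μ r - N r ≤ collapseTime μ r - centralTime μ := by
      linarith [(hN r (hmem r hr)).1]
    have hpos : 0 < collapseTime μ r - N r := by linarith [(hN r (hmem r hr)).2.1]
    have h2 : massRate μ r * (collapseTime μ r - N r)
        ≤ 1 / r * (collapseTime μ r - centralTime μ) :=
      mul_le_mul hg hgap hpos.le (by positivity)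
    have h3 : 3 * (1 / r * (collapseTime μ r - centralTime μ)) ≤ 2 * collapseRate μ r := by
      have e1 : 3 * (1 / r * (collapseTime μ r - centralTime μ))
          = 3 * ((collapseTime μ r - centralTime μ) / r ^ 3) * r ^ 2 := by field_simp
      have e2 : 2 * collapseRate μ r = 2 * (collapseRate μ r / r ^ 2) * r ^ 2 := by field_simp
      rw [e1, e2]
      exact mul_le_mul_of_nonneg_right h1.le (by positivity)
    linarith
  · obtain ⟨x, hx, hxu⟩ := hun (min u ρ) hσ
    exact ⟨x, hx, hxu⟩

/-- If a radial null geodesic emanates from the singularity, then so do timelike geodesics with any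
angular momentum. -/
lemma RadialNullEmanates.timelike (hμ : IsRegularData b μ) (hem : RadialNullEmanates b μ) (L : ℝ) :
    Emanates b μ 1 L := by
  obtain ⟨ρ, hρ, C, N, N', hN⟩ : ∃ ρ, IsCore b μ ρ ∧ ∃ C N N', IsBarrier μ ρ C N N' := by
    rcases collapseRate_dichotomy hμ with h | ⟨c, h⟩
    · exact exists_barrier_of_tendsto_atTop hμ h
    · exact exists_barrier_of_tendsto_nhds hμ h hem
  exact hN.emanates hμ hρ L zero_le_one le_rfl

end Asymptotics

end MarginallyBoundDust

end

theorem theorem2 (b : ℝ) (μ : ℝ → ℝ) (hμ : MarginallyBoundDust.IsRegularData b μ) :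
    (MarginallyBoundDust.RadialTimelikeEmanates b μ ↔
      MarginallyBoundDust.RadialNullEmanates b μ) ∧
    (MarginallyBoundDust.NonradialTimelikeEmanates b μ ↔
      MarginallyBoundDust.RadialNullEmanates b μ) ∧
    (¬ MarginallyBoundDust.RadialNullEmanates b μ →
      ¬ MarginallyBoundDust.CausalEmanates b μ) := by
  refine ⟨⟨fun h => ?_, fun h => h.timelike hμ 0⟩,
    ⟨?_, fun h => ⟨1, one_ne_zero, h.timelike hμ 1⟩⟩, ?_⟩
  · exact MarginallyBoundDust.radialNullEmanates_of_emanates hμ zero_le_one (by norm_num) h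
  · rintro ⟨L, -, h⟩
    exact MarginallyBoundDust.radialNullEmanates_of_emanates hμ zero_le_one (by positivity) h
  · rintro hn ⟨ε, L, hε, h⟩
    apply hn
    rcases hε with rfl | rfl
    -- A nonradial null geodesic has `ε + L² = L² > 0`, so the comparison argument covers it too.
    · by_cases hL : L = 0
      · subst hL; exact h
      · exact MarginallyBoundDust.radialNullEmanates_of_emanates hμ le_rfl (by positivity) h
    · exact MarginallyBoundDust.radialNullEmanates_of_emanates hμ zero_le_one (by positivity) h
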